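/- Let $p$ be a prime and $h\ge 0$. For a finite discrete group $G$ and continuous homomorphisms $\alpha,\beta:\mathbb Z_p^h\to G$, let $C(\alpha,\beta)=\{g\in G: g\alpha g^{-1}=\beta\}$, and let $T(\alpha,\beta)$ be the quotient space of $C(\alpha,\beta)\times\mathbb Q_p^h$ by the relation $[g,t+j]=[g\alpha(j),t]$ for $j\in\mathbb Z_p^h$. These spaces have the composition $[k,s][g,t]=[kg,s+t]$, and $T(\alpha)=T(\alpha,\alpha)$ is a topological group. For a $G$-space $X$ put $[g,t]x=gx$; this gives maps $T(\alpha,\beta)\times X^{\operatorname{im}\alpha}\to X^{\operatorname{im}\beta}$. Let $\mathcal T^G_h(X)$ be the topological groupoid with objects $\coprod_{\alpha}X^{\operatorname{im}\alpha}$, with morphisms $\coprod_{(\alpha,\beta)}T(\alpha,\beta)\times X^{\operatorname{im}\alpha}$, and with domain and codomain maps $d([g,t],x)=x$ and $c([g,t],x)=gx$. Here $\alpha,\beta$ run over all continuous homomorphisms $\mathbb Z_p^h\to G$. Let $$\mathrm{Twist}^G_h(X)=\coprod_{[\alpha]}ET(\alpha)\times_{T(\alpha)}X^{\operatorname{im}\alpha},$$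 where the coproduct is over conjugacy classes of continuous homomorphisms $\mathbb Z_p^h\to G$, with a chosen representative $\alpha$ of each class. Let $H\subseteq G$ be an abelian subgroup with inclusion $i:H\to G$. Let $F:\mathcal T^H_h(*)\to\mathcal T^G_h(G/H)$ be the map of topological groupoids that sends the object $*\in *^{\operatorname{im}\alpha}$ to $eH\in(G/H)^{\operatorname{im}(i\alpha)}$ and the morphism $([g,t],*)$ with $[g,t]\in T(\alpha,\alpha')$ to $([g,t],eH)$ with $[g,t]\in T(i\alpha,i\alpha')$. Then: 1. $F$ is an equivalence of topological groupoids. That is, it is fully faithful: the square formed by $F$ on morphisms, $F\times F$ on pairs of objects and the two maps $(d,c)$ is a pullback of spaces. It is also essentially surjective: the map $(m,a)\mapsto c(m)$, from the fibre product of the morphisms of $\mathcal T^G_h(G/H)$ (along $d$) and the objects of $\mathcal T^H_h(*)$ (along $F$) to the objects of $\mathcal T^G_h(G/H)$, admits local sections. 2. The map induced by $F$ on geometric realizations of nerves is a homotopy equivalence $|\mathcal T^H_h(*)|\to|\mathcal T^G_h(G/H)|$. 3. There is a homotopy equivalence $\mathrm{Twist}^G_h(G/H)\simeq\mathrm{Twist}^H_h(*)$.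 -/

import Mathlib

open scoped ContinuousMap

universe u v w

noncomputable section

/-! ## Topological groupoids -/

/-- A topological groupoid: spaces of objects and of morphisms with continuous structure maps. -/
structure TopGroupoid where
  Obj : Type u
  Mor : Type u
  [topObj : TopologicalSpace Obj]
  [topMor : TopologicalSpace Mor]
  /-- the domain map `d` -/
  dom : Mor → Obj
  /-- the codomain map `c` -/
  cod : Mor → Obj
  ident : Obj → Mor
  inv : Mor → Mor
  /-- `comp m n e` is the composite "first `n`, then `m`" -/
  comp : (m n : Mor) → dom m = cod n → Mor
  continuous_dom : Continuous dom
  continuous_cod : Continuous cod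
  continuous_ident : Continuous ident
  continuous_inv : Continuous inv
  continuous_comp : Continuous
    fun q : {q : Mor × Mor // dom q.1 = cod q.2} => comp q.1.1 q.1.2 q.2
  dom_ident : ∀ x, dom (ident x) = x
  cod_ident : ∀ x, cod (ident x) = x
  dom_inv : ∀ m, dom (inv m) = cod m
  cod_inv : ∀ m, cod (inv m) = dom m
  dom_comp : ∀ m n e, dom (comp m n e) = dom n
  cod_comp : ∀ m n e, cod (comp m n e) = cod m
  comp_ident : ∀ m, comp m (ident (dom m)) (cod_ident _).symm = m
  ident_comp : ∀ m, comp (ident (cod m)) m (dom_ident _) = m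
  comp_inv : ∀ m, comp m (inv m) (cod_inv m).symm = ident (cod m)
  inv_comp : ∀ m, comp (inv m) m (dom_inv m) = ident (dom m)
  assoc : ∀ (l m n : Mor) (e : dom l = cod m) (e' : dom m = cod n),
    comp (comp l m e) n ((dom_comp l m e).trans e') =
      comp l (comp m n e') (e.trans (cod_comp m n e').symm)

namespace TopGroupoid

attribute [instance] TopGroupoid.topObj TopGroupoid.topMor

/-- A map of topological groupoids: a continuous functor. -/
structure Hom (𝒜 : TopGroupoid.{u}) (ℬ : TopGroupoid.{u}) where
  obj : 𝒜.Obj → ℬ.Obj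
  mor : 𝒜.Mor → ℬ.Mor
  continuous_obj : Continuous obj
  continuous_mor : Continuous mor
  dom_mor : ∀ m, ℬ.dom (mor m) = obj (𝒜.dom m)
  cod_mor : ∀ m, ℬ.cod (mor m) = obj (𝒜.cod m)
  mor_ident : ∀ x, mor (𝒜.ident x) = ℬ.ident (obj x)
  mor_comp : ∀ m n (e : 𝒜.dom m = 𝒜.cod n),
    mor (𝒜.comp m n e) =
      ℬ.comp (mor m) (mor n) ((dom_mor m).trans ((congrArg obj e).trans (cod_mor n).symm))

namespace Hom

variable {𝒜 ℬ : TopGroupoid.{u}}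

/-- Fully faithful: the square formed by `mor`, `(d, c)`, `(d, c)` and `obj × obj` is a pullback
of topological spaces. -/
def FullyFaithful (F : Hom 𝒜 ℬ) : Prop :=
  IsHomeomorph (fun m : 𝒜.Mor =>
    (⟨(F.mor m, (𝒜.dom m, 𝒜.cod m)), Prod.ext (F.dom_mor m) (F.cod_mor m)⟩ :
      {q : ℬ.Mor × (𝒜.Obj × 𝒜.Obj) //
        (ℬ.dom q.1, ℬ.cod q.1) = (F.obj q.2.1, F.obj q.2.2)}))

/-- Essentially surjective: the map `(m, a) ↦ c m` from the fibre product
`ℬ.Mor ×_{ℬ.Obj} 𝒜.Obj` (along `d` and `obj`) to `ℬ.Obj` admits local sections. -/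
def EssSurjective (F : Hom 𝒜 ℬ) : Prop :=
  ∀ y : ℬ.Obj, ∃ U : Set ℬ.Obj, IsOpen U ∧ y ∈ U ∧
    ∃ s : U → {q : ℬ.Mor × 𝒜.Obj // ℬ.dom q.1 = F.obj q.2},
      Continuous s ∧ ∀ z : U, ℬ.cod (s z).1.1 = z

/-- Equivalence of topological groupoids. -/
def IsEquivalence (F : Hom 𝒜 ℬ) : Prop :=
  F.FullyFaithful ∧ F.EssSurjective

end Hom

/-- The `n`-simplices of the nerve: functors from the ordered set `{0 ≤ 1 ≤ ⋯ ≤ n}` to `𝒢`. -/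
@[ext]
structure Nerve (𝒢 : TopGroupoid.{u}) (n : ℕ) where
  vert : Fin (n + 1) → 𝒢.Obj
  edge : {q : Fin (n + 1) × Fin (n + 1) // q.1 ≤ q.2} → 𝒢.Mor
  dom_edge : ∀ q, 𝒢.dom (edge q) = vert q.1.1
  cod_edge : ∀ q, 𝒢.cod (edge q) = vert q.1.2
  edge_refl : ∀ i, edge ⟨(i, i), le_refl i⟩ = 𝒢.ident (vert i)
  edge_trans : ∀ i j k (hij : i ≤ j) (hjk : j ≤ k),
    edge ⟨(i, k), hij.trans hjk⟩ = 𝒢.comp (edge ⟨(j, k), hjk⟩) (edge ⟨(i, j), hij⟩)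
      ((dom_edge ⟨(j, k), hjk⟩).trans (cod_edge ⟨(i, j), hij⟩).symm)

namespace Nerve

/-- The subspace topology coming from the product of copies of `𝒢.Obj` and `𝒢.Mor`. -/
instance (𝒢 : TopGroupoid.{u}) (n : ℕ) : TopologicalSpace (Nerve 𝒢 n) :=
  TopologicalSpace.induced (fun σ => (σ.vert, σ.edge)) inferInstance

/-- The simplicial operator of a monotone map. -/
def pull {𝒢 : TopGroupoid.{u}} {m n : ℕ} (θ : Fin (m + 1) →o Fin (n + 1)) (σ : Nerve 𝒢 n) :
    Nerve 𝒢 m where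
  vert i := σ.vert (θ i)
  edge q := σ.edge ⟨(θ q.1.1, θ q.1.2), θ.monotone q.2⟩
  dom_edge _ := σ.dom_edge _
  cod_edge _ := σ.cod_edge _
  edge_refl _ := σ.edge_refl _
  edge_trans _ _ _ _ _ := σ.edge_trans _ _ _ _ _

/-- Functoriality of the nerve. -/
def push {𝒜 ℬ : TopGroupoid.{u}} (F : Hom 𝒜 ℬ) {n : ℕ} (σ : Nerve 𝒜 n) : Nerve ℬ n where
  vert i := F.obj (σ.vert i)
  edge q := F.mor (σ.edge q)
  dom_edge q := by rw [F.dom_mor, σ.dom_edge]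
  cod_edge q := by rw [F.cod_mor, σ.cod_edge]
  edge_refl i := by rw [σ.edge_refl, F.mor_ident]
  edge_trans i j k hij hjk := by rw [σ.edge_trans i j k hij hjk, F.mor_comp]

theorem continuous_push {𝒜 ℬ : TopGroupoid.{u}} (F : Hom 𝒜 ℬ) {n : ℕ} :
    Continuous (push F : Nerve 𝒜 n → Nerve ℬ n) := by
  have hc : Continuous fun σ : Nerve 𝒜 n => (σ.vert, σ.edge) := continuous_induced_dom
  refine continuous_induced_rng.2 (Continuous.prodMk ?_ ?_)
  · exact continuous_pi fun i => F.continuous_obj.comp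
      ((continuous_apply i).comp (continuous_fst.comp hc))
  · exact continuous_pi fun q => F.continuous_mor.comp
      ((continuous_apply q).comp (continuous_snd.comp hc))

end Nerve

/-- Pairs of a simplex of the nerve and a point of the standard topological simplex. -/
abbrev PreRealization (𝒢 : TopGroupoid.{u}) : Type u :=
  Σ n : ℕ, Nerve 𝒢 n × stdSimplex ℝ (Fin (n + 1))

/-- The gluing `(θ^* σ, t) ∼ (σ, θ_* t)`. -/
inductive Glue (𝒢 : TopGroupoid.{u}) : PreRealization 𝒢 → PreRealization 𝒢 → Prop
  | mk {m n : ℕ} (θ : Fin (m + 1) →o Fin (n + 1)) (σ : Nerve 𝒢 n)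
      (t : stdSimplex ℝ (Fin (m + 1))) :
      Glue 𝒢 ⟨m, (σ.pull θ, t)⟩ ⟨n, (σ, stdSimplex.map θ t)⟩

/-- The geometric realization of the nerve (a simplicial space), with the quotient topology. -/
def Realization (𝒢 : TopGroupoid.{u}) : Type u :=
  Quot (Glue 𝒢)

instance (𝒢 : TopGroupoid.{u}) : TopologicalSpace (Realization 𝒢) :=
  inferInstanceAs (TopologicalSpace (Quot (Glue 𝒢)))

/-- The map of realizations induced by a map of topological groupoids. -/
def Hom.realize {𝒜 ℬ : TopGroupoid.{u}} (F : Hom 𝒜 ℬ) :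
    C(Realization 𝒜, Realization ℬ) where
  toFun := Quot.map (fun z : PreRealization 𝒜 =>
      (⟨z.1, (Nerve.push F z.2.1, z.2.2)⟩ : PreRealization ℬ)) (by
    rintro _ _ ⟨θ, σ, t⟩
    exact Glue.mk θ (Nerve.push F σ) t)
  continuous_toFun := by
    refine continuous_quot_lift _ (continuous_quot_mk.comp ?_)
    refine continuous_sigma fun n => continuous_sigmaMk.comp ?_
    exact ((Nerve.continuous_push F).comp continuous_fst).prodMk continuous_snd

end TopGroupoid

/-! ## The Borel construction -/

/-- The groupoid with space of objects `T` and exactly one morphism between any two objects. -/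
def chaoticGroupoid (T : Type u) [TopologicalSpace T] : TopGroupoid.{u} where
  Obj := T
  Mor := T × T
  dom := Prod.fst
  cod := Prod.snd
  ident a := (a, a)
  inv m := (m.2, m.1)
  comp m n _ := (n.1, m.2)
  continuous_dom := by fun_prop
  continuous_cod := by fun_prop
  continuous_ident := by fun_prop
  continuous_inv := by fun_prop
  continuous_comp := by fun_prop
  dom_ident _ := rfl
  cod_ident _ := rfl
  dom_inv _ := rfl
  cod_inv _ := rfl
  dom_comp _ _ _ := rfl
  cod_comp _ _ _ := rfl
  comp_ident _ := rfl
  ident_comp _ := rfl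
  comp_inv _ := rfl
  inv_comp _ := rfl
  assoc _ _ _ _ _ := rfl

/-- Left translation by an element of a topological group `T`. -/
def chaoticTranslate {T : Type u} [TopologicalSpace T] [Group T] [IsTopologicalGroup T] (a : T) :
    TopGroupoid.Hom (chaoticGroupoid T) (chaoticGroupoid T) where
  obj := fun x : T => a * x
  mor := fun m : T × T => (a * m.1, a * m.2)
  continuous_obj := continuous_const_mul a
  continuous_mor := ((continuous_const_mul a).comp continuous_fst).prodMk
    ((continuous_const_mul a).comp continuous_snd)
  dom_mor _ := rfl
  cod_mor _ := rfl
  mor_ident _ := rfl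
  mor_comp _ _ _ := rfl

/-- The contractible space `ET` with free `T`-action: the realization of the simplicial space
`n ↦ T ^ (n + 1)`. -/
abbrev UniversalSpace (T : Type u) [TopologicalSpace T] : Type u :=
  TopGroupoid.Realization (chaoticGroupoid T)

/-- The Borel construction `ET ×_T Y`: the orbit space of the diagonal action of `T` on
`ET × Y`. -/
def BorelConstruction (T : Type u) [TopologicalSpace T] [Group T] [IsTopologicalGroup T]
    (Y : Type v) [TopologicalSpace Y] [MulAction T Y] : Type (max u v) :=
  Quot fun z z' : UniversalSpace T × Y =>
    ∃ a : T, z' = ((chaoticTranslate a).realize z.1, a • z.2)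

instance (T : Type u) [TopologicalSpace T] [Group T] [IsTopologicalGroup T]
    (Y : Type v) [TopologicalSpace Y] [MulAction T Y] : TopologicalSpace (BorelConstruction T Y) :=
  inferInstanceAs (TopologicalSpace (Quot fun z z' : UniversalSpace T × Y =>
    ∃ a : T, z' = ((chaoticTranslate a).realize z.1, a • z.2)))

/-! ## The spaces `T(α, β)` -/

/-- The group `ℤ_p ^ h`, written multiplicatively, with its `p`-adic topology. -/
abbrev ZpPow (p : ℕ) [Fact p.Prime] (h : ℕ) : Type :=
  Multiplicative (Fin h → ℤ_[p])

/-- The inclusion `ℤ_p ^ h → ℚ_p ^ h`. -/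
def zpToQp {p : ℕ} [Fact p.Prime] {h : ℕ} (j : ZpPow p h) : Fin h → ℚ_[p] :=
  fun i => (j.toAdd i : ℚ_[p])

section Twist

variable {p : ℕ} [Fact p.Prime] {h : ℕ}
variable {G : Type u} [Group G] [TopologicalSpace G]

theorem zpToQp_one : zpToQp (1 : ZpPow p h) = 0 := by
  funext i; simp [zpToQp]

theorem zpToQp_mul (j k : ZpPow p h) : zpToQp (j * k) = zpToQp j + zpToQp k := by
  funext i; simp [zpToQp]

theorem zpToQp_inv (j : ZpPow p h) : zpToQp j⁻¹ = -zpToQp j := by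
  funext i; simp [zpToQp]

/-- `C(α, β)`: the elements of `G` that conjugate `α` to `β`. -/
def Conjugators (α β : ZpPow p h →ₜ* G) : Set G :=
  {g | ∀ j, g * α j * g⁻¹ = β j}

theorem Conjugators.mul_eq {α β : ZpPow p h →ₜ* G} {g : G} (hg : g ∈ Conjugators α β)
    (j : ZpPow p h) : g * α j = β j * g := by
  rw [← hg j]; group

theorem Conjugators.of_mul_eq {α β : ZpPow p h →ₜ* G} {g : G}
    (hg : ∀ j, g * α j = β j * g) : g ∈ Conjugators α β := fun j => by
  rw [hg j]; group

theorem Conjugators.one_mem (α : ZpPow p h →ₜ* G) : (1 : G) ∈ Conjugators α α := fun j => by simp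

theorem Conjugators.inv_mem {α β : ZpPow p h →ₜ* G} {g : G} (hg : g ∈ Conjugators α β) :
    g⁻¹ ∈ Conjugators β α := fun j => by
  rw [← hg j]; group

theorem Conjugators.comp_mem {α β δ : ZpPow p h →ₜ* G} {k g : G} (hk : k ∈ Conjugators β δ)
    (hg : g ∈ Conjugators α β) : k * g ∈ Conjugators α δ := fun j => by
  rw [← hk j, ← hg j]; group

/-- The relation `[g, t + j] = [g α(j), t]`, for `j ∈ ℤ_p ^ h`. -/
def twistSetoid (α β : ZpPow p h →ₜ* G) : Setoid (Conjugators α β × (Fin h → ℚ_[p])) where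
  r a b := ∃ j : ZpPow p h, (b.1 : G) = a.1 * α j ∧ a.2 = b.2 + zpToQp j
  iseqv :=
    { refl := fun a => ⟨1, by simp, by simp [zpToQp_one]⟩
      symm := by
        rintro a b ⟨j, h1, h2⟩
        exact ⟨j⁻¹, by rw [h1, map_inv]; group, by rw [h2, zpToQp_inv]; abel⟩
      trans := by
        rintro a b c ⟨j, h1, h2⟩ ⟨k, h3, h4⟩
        exact ⟨j * k, by rw [h3, h1, map_mul, mul_assoc],
          by rw [h2, h4, zpToQp_mul]; abel⟩ }

/-- `T(α, β)`: the coequalizer of `C(α, β) × ℤ_p ^ h × ℚ_p ^ h ⇉ C(α, β) × ℚ_p ^ h`. -/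
def TwistHom (α β : ZpPow p h →ₜ* G) : Type u :=
  Quotient (twistSetoid α β)

namespace TwistHom

instance (α β : ZpPow p h →ₜ* G) : TopologicalSpace (TwistHom α β) :=
  inferInstanceAs (TopologicalSpace (Quotient (twistSetoid α β)))

/-- The class `[g, t]`. -/
def mk {α β : ZpPow p h →ₜ* G} (g : G) (hg : g ∈ Conjugators α β) (t : Fin h → ℚ_[p]) :
    TwistHom α β :=
  Quotient.mk (twistSetoid α β) (⟨g, hg⟩, t)

theorem ind {α β : ZpPow p h →ₜ* G} {P : TwistHom α β → Prop}
    (H : ∀ g hg t, P (mk g hg t)) (τ : TwistHom α β) : P τ :=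
  Quotient.ind (fun a => H a.1.1 a.1.2 a.2) τ

theorem mk_congr {α β : ZpPow p h →ₜ* G} {g g' : G} {hg : g ∈ Conjugators α β}
    {hg' : g' ∈ Conjugators α β} {t t' : Fin h → ℚ_[p]} (h1 : g = g') (h2 : t = t') :
    mk g hg t = mk g' hg' t' := by
  subst h1 h2; rfl

/-- The identity `[e, 0]`. -/
def one (α : ZpPow p h →ₜ* G) : TwistHom α α :=
  mk 1 (Conjugators.one_mem α) 0

/-- The composition `[k, s] [g, t] = [k g, s + t]`. -/
def comp {α β δ : ZpPow p h →ₜ* G} (τ : TwistHom β δ) (τ' : TwistHom α β) : TwistHom α δ :=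
  Quotient.map₂ (sa := twistSetoid β δ) (sb := twistSetoid α β) (sc := twistSetoid α δ)
    (fun a b => (⟨a.1.1 * b.1.1, Conjugators.comp_mem a.1.2 b.1.2⟩, a.2 + b.2)) (by
      rintro a a' ⟨j, h1, h2⟩ b b' ⟨k, h3, h4⟩
      refine ⟨j * k, ?_, ?_⟩
      · change (a'.1.1 * b'.1.1 : G) = a.1.1 * b.1.1 * α (j * k)
        have := Conjugators.mul_eq b.1.2 j
        calc a'.1.1 * b'.1.1 = a.1.1 * (β j * b.1.1) * α k := by rw [h1, h3]; group
          _ = a.1.1 * b.1.1 * α (j * k) := by rw [← this, map_mul]; group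
      · change a.2 + b.2 = a'.2 + b'.2 + zpToQp (j * k)
        rw [h2, h4, zpToQp_mul]; abel) τ τ'

/-- The inverse `[g, t]⁻¹ = [g⁻¹, -t]`. -/
def inv {α β : ZpPow p h →ₜ* G} (τ : TwistHom α β) : TwistHom β α :=
  Quotient.map (sa := twistSetoid α β) (sb := twistSetoid β α)
    (fun a => (⟨a.1.1⁻¹, Conjugators.inv_mem a.1.2⟩, -a.2)) (by
      rintro a a' ⟨j, h1, h2⟩
      refine ⟨j⁻¹, ?_, ?_⟩
      · change (a'.1.1⁻¹ : G) = a.1.1⁻¹ * β j⁻¹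
        rw [h1, Conjugators.mul_eq a.1.2, mul_inv_rev, map_inv]
      · change -a.2 = -a'.2 + zpToQp j⁻¹
        rw [h2, zpToQp_inv]; abel) τ

/-- Transport along an equality of targets. -/
def castCod {α β β' : ZpPow p h →ₜ* G} (e : β' = β) (τ : TwistHom α β') : TwistHom α β :=
  e ▸ τ

@[simp]
theorem castCod_rfl {α β : ZpPow p h →ₜ* G} (e : β = β) (τ : TwistHom α β) :
    castCod e τ = τ := rfl

theorem comp_assoc {α β δ ε : ZpPow p h →ₜ* G} (τ : TwistHom δ ε) (τ' : TwistHom β δ)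
    (τ'' : TwistHom α β) : comp (comp τ τ') τ'' = comp τ (comp τ' τ'') := by
  induction τ using ind; induction τ' using ind; induction τ'' using ind
  exact mk_congr (mul_assoc _ _ _) (add_assoc _ _ _)

theorem one_comp {α β : ZpPow p h →ₜ* G} (τ : TwistHom α β) : comp (one β) τ = τ := by
  induction τ using ind
  exact mk_congr (one_mul _) (zero_add _)

theorem comp_one {α β : ZpPow p h →ₜ* G} (τ : TwistHom α β) : comp τ (one α) = τ := by
  induction τ using ind
  exact mk_congr (mul_one _) (add_zero _)

theorem inv_comp {α β : ZpPow p h →ₜ* G} (τ : TwistHom α β) : comp (inv τ) τ = one α := by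
  induction τ using ind
  exact mk_congr (inv_mul_cancel _) (neg_add_cancel _)

theorem comp_inv {α β : ZpPow p h →ₜ* G} (τ : TwistHom α β) : comp τ (inv τ) = one β := by
  induction τ using ind
  exact mk_congr (mul_inv_cancel _) (add_neg_cancel _)

/-- The group `T(α) = T(α, α)`. -/
instance (α : ZpPow p h →ₜ* G) : Group (TwistHom α α) where
  mul := comp
  one := one α
  inv := inv
  mul_assoc := comp_assoc
  one_mul := one_comp
  mul_one := comp_one
  inv_mul_cancel := inv_comp

theorem isOpenMap_zpToQp : IsOpenMap (zpToQp : ZpPow p h → Fin h → ℚ_[p]) := by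
  have key : IsOpenMap (Pi.map (fun _ : Fin h => ((↑) : ℤ_[p] → ℚ_[p]))) :=
    IsOpenMap.piMap (fun _ => PadicInt.isOpenEmbedding_coe.isOpenMap)
      (by simp [Filter.cofinite_eq_bot])
  exact key

/-- As `ℤ_p ^ h` is open in `ℚ_p ^ h`, the quotient topology on `T(α, β)` is discrete. -/
instance [DiscreteTopology G] (α β : ZpPow p h →ₜ* G) : DiscreteTopology (TwistHom α β) := by
  refine discreteTopology_iff_forall_isOpen.2 fun S => ?_
  refine isOpen_coinduced.2 ?_
  refine isOpen_iff_mem_nhds.2 ?_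
  rintro ⟨g, t⟩ hgt
  have hU : IsOpen {j : ZpPow p h | α j = 1} :=
    (isOpen_discrete ({1} : Set G)).preimage (map_continuous α)
  have hV : IsOpen ((fun s => t + s) '' (zpToQp '' {j : ZpPow p h | α j = 1})) :=
    (Homeomorph.addLeft t).isOpenMap _ (isOpenMap_zpToQp _ hU)
  have hW : IsOpen (({g} : Set (Conjugators α β)) ×ˢ
      ((fun s => t + s) '' (zpToQp '' {j : ZpPow p h | α j = 1}))) :=
    (isOpen_discrete _).prod hV
  refine Filter.mem_of_superset (hW.mem_nhds ⟨rfl, ?_⟩) ?_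
  · exact ⟨0, ⟨1, map_one α, zpToQp_one⟩, add_zero t⟩
  · rintro ⟨g', t'⟩ ⟨hg', s, ⟨j, hj, rfl⟩, rfl⟩
    obtain rfl : g' = g := hg'
    have : (Quotient.mk (twistSetoid α β) (g', t + zpToQp j)) =
        Quotient.mk (twistSetoid α β) (g', t) :=
      Quotient.sound ⟨j, by rw [show α j = 1 from hj, mul_one], rfl⟩
    change (Quotient.mk (twistSetoid α β) (g', t + zpToQp j)) ∈ S
    rw [this]
    exact hgt

instance [DiscreteTopology G] (α : ZpPow p h →ₜ* G) : IsTopologicalGroup (TwistHom α α) where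
  continuous_mul := continuous_of_discreteTopology
  continuous_inv := continuous_of_discreteTopology

end TwistHom

/-! ## Fixed points and the action of `T(α, β)` -/

variable {X : Type w} [MulAction G X]

/-- The fixed point space `X ^ (im α)`. -/
abbrev FixedSpace (α : ZpPow p h →ₜ* G) (X : Type w) [MulAction G X] : Type w :=
  MulAction.fixedPoints (α : ZpPow p h →* G).range X

theorem FixedSpace.smul_eq {α : ZpPow p h →ₜ* G} (x : FixedSpace α X) (j : ZpPow p h) :
    α j • (x : X) = x :=
  x.2 ⟨α j, j, rfl⟩

theorem FixedSpace.smul_mem {α β : ZpPow p h →ₜ* G} {g : G} (hg : g ∈ Conjugators α β)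
    (x : FixedSpace α X) :
    g • (x : X) ∈ MulAction.fixedPoints (β : ZpPow p h →* G).range X := by
  rintro ⟨_, j, rfl⟩
  change β j • g • (x : X) = g • (x : X)
  rw [smul_smul, ← Conjugators.mul_eq hg, mul_smul, FixedSpace.smul_eq]

/-- The map `T(α, β) × X ^ (im α) → X ^ (im β)`, `[g, t] x = g x`. -/
def TwistHom.act {α β : ZpPow p h →ₜ* G} (τ : TwistHom α β) (x : FixedSpace α X) :
    FixedSpace β X :=
  Quotient.lift (s := twistSetoid α β)
    (fun a => (⟨a.1.1 • (x : X), FixedSpace.smul_mem a.1.2 x⟩ : FixedSpace β X)) (by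
      rintro a b ⟨j, h1, -⟩
      refine Subtype.ext ?_
      change a.1.1 • (x : X) = b.1.1 • (x : X)
      rw [h1, mul_smul, FixedSpace.smul_eq]) τ

theorem TwistHom.one_act {α : ZpPow p h →ₜ* G} (x : FixedSpace α X) :
    (TwistHom.one α).act x = x :=
  Subtype.ext (one_smul G (x : X))

theorem TwistHom.comp_act {α β δ : ZpPow p h →ₜ* G} (τ : TwistHom β δ) (τ' : TwistHom α β)
    (x : FixedSpace α X) : (τ.comp τ').act x = τ.act (τ'.act x) := by
  induction τ using ind; induction τ' using ind
  exact Subtype.ext (mul_smul _ _ (x : X))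

theorem TwistHom.continuous_act [TopologicalSpace X] [ContinuousConstSMul G X] {α β : ZpPow p h →ₜ* G}
    (τ : TwistHom α β) : Continuous (τ.act : FixedSpace α X → FixedSpace β X) := by
  induction τ using ind with
  | H g hg t => exact ((continuous_const_smul g).comp continuous_subtype_val).subtype_mk _

theorem TwistHom.continuous_act_prod [DiscreteTopology G] [TopologicalSpace X]
    [ContinuousConstSMul G X] (α β : ZpPow p h →ₜ* G) :
    Continuous fun z : TwistHom α β × FixedSpace α X => z.1.act z.2 :=
  continuous_prod_of_discrete_left.2 fun τ => τ.continuous_act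

theorem TwistHom.continuous_inv [DiscreteTopology G] (α β : ZpPow p h →ₜ* G) :
    Continuous fun τ : TwistHom α β => τ.inv :=
  continuous_of_discreteTopology

instance (α : ZpPow p h →ₜ* G) : MulAction (TwistHom α α) (FixedSpace α X) where
  smul := TwistHom.act
  one_smul := TwistHom.one_act
  mul_smul := TwistHom.comp_act

/-! ## The two forms of the construction `Twist` -/

variable (p h G) in
/-- Conjugacy of continuous homomorphisms `ℤ_p ^ h → G`. -/
def conjSetoid : Setoid (ZpPow p h →ₜ* G) where
  r α β := ∃ g : G, g ∈ Conjugators α β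
  iseqv :=
    { refl := fun α => ⟨1, Conjugators.one_mem α⟩
      symm := fun ⟨g, hg⟩ => ⟨g⁻¹, Conjugators.inv_mem hg⟩
      trans := fun ⟨g, hg⟩ ⟨k, hk⟩ => ⟨k * g, Conjugators.comp_mem hk hg⟩ }

variable (p h G) in
/-- `Twist_h^G(X) = ∐_{[α]} ET(α) ×_{T(α)} X ^ (im α)`, the coproduct being over conjugacy
classes, with a chosen representative `α` of each class. -/
abbrev Twist [DiscreteTopology G] (X : Type w) [TopologicalSpace X] [MulAction G X] :
    Type (max u w) :=
  Σ c : Quotient (conjSetoid p h G), BorelConstruction (TwistHom c.out c.out) (FixedSpace c.out X)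

variable (p h G) in
/-- The objects `∐_α X ^ (im α)`. -/
abbrev TwistObj (X : Type w) [MulAction G X] : Type (max u w) :=
  Σ α : ZpPow p h →ₜ* G, FixedSpace α X

variable (p h G) in
/-- The morphisms `∐_{(α, β)} T(α, β) × X ^ (im α)`. -/
abbrev TwistMor (X : Type w) [MulAction G X] : Type (max u w) :=
  Σ ab : (ZpPow p h →ₜ* G) × (ZpPow p h →ₜ* G), TwistHom ab.1 ab.2 × FixedSpace ab.1 X

namespace TwistMor

/-- `([g, t], x) ↦ x`. -/
def dom (m : TwistMor p h G X) : TwistObj p h G X := ⟨m.1.1, m.2.2⟩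

/-- `([g, t], x) ↦ g x`. -/
def cod (m : TwistMor p h G X) : TwistObj p h G X := ⟨m.1.2, m.2.1.act m.2.2⟩

/-- `x ↦ ([e, 0], x)`. -/
def ident (x : TwistObj p h G X) : TwistMor p h G X := ⟨(x.1, x.1), (TwistHom.one x.1, x.2)⟩

/-- `([g, t], x) ↦ ([g, t]⁻¹, g x)`. -/
def inv (m : TwistMor p h G X) : TwistMor p h G X :=
  ⟨(m.1.2, m.1.1), (m.2.1.inv, m.2.1.act m.2.2)⟩

/-- `([k, s], g x) ∘ ([g, t], x) = ([k g, s + t], x)`. -/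
def comp (m n : TwistMor p h G X) (e : dom m = cod n) : TwistMor p h G X :=
  ⟨(n.1.1, m.1.2),
    (m.2.1.comp (n.2.1.castCod (congrArg Sigma.fst e).symm), n.2.2)⟩

theorem comp_mk {α β δ : ZpPow p h →ₜ* G} (τ : TwistHom β δ) (τ' : TwistHom α β)
    (x : FixedSpace α X) :
    comp (⟨(β, δ), (τ, τ'.act x)⟩ : TwistMor p h G X) ⟨(α, β), (τ', x)⟩ rfl =
      ⟨(α, δ), (τ.comp τ', x)⟩ := rfl

theorem mk_congr {α β : ZpPow p h →ₜ* G} {τ τ' : TwistHom α β} (e : τ = τ')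
    (x : FixedSpace α X) :
    (⟨(α, β), (τ, x)⟩ : TwistMor p h G X) = ⟨(α, β), (τ', x)⟩ := by rw [e]

/-- Every composable pair is of the standard form. -/
theorem composable_ind {P : ∀ m n : TwistMor p h G X, dom m = cod n → Prop}
    (H : ∀ (α β δ : ZpPow p h →ₜ* G) (τ : TwistHom β δ) (τ' : TwistHom α β)
      (x : FixedSpace α X), P ⟨(β, δ), (τ, τ'.act x)⟩ ⟨(α, β), (τ', x)⟩ rfl)
    (m n : TwistMor p h G X) (e : dom m = cod n) : P m n e := by
  obtain ⟨⟨β, δ⟩, τ, y⟩ := m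
  obtain ⟨⟨α, β'⟩, τ', x⟩ := n
  simp only [dom, cod] at e
  cases e
  exact H α β δ τ τ' x

end TwistMor

/-- The morphism space is a subspace of a product with a discrete first factor. -/
theorem TwistMor.isInducing [TopologicalSpace X] [DiscreteTopology G] : Topology.IsInducing
    (fun m : TwistMor p h G X =>
      ((⟨m.1, m.2.1⟩ : Σ ab : (ZpPow p h →ₜ* G) × (ZpPow p h →ₜ* G), TwistHom ab.1 ab.2),
        (m.2.2 : X))) := by
  refine inducing_sigma.2 ⟨fun ab => ?_, fun ab => ?_⟩
  · exact (Topology.IsEmbedding.sigmaMk (i := ab)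
      (σ := fun ab : (ZpPow p h →ₜ* G) × (ZpPow p h →ₜ* G) =>
        TwistHom ab.1 ab.2)).isInducing.prodMap Topology.IsInducing.subtypeVal
  · exact ⟨{z | z.1.1 = ab}, (isOpen_discrete {z : Σ ab : (ZpPow p h →ₜ* G) × (ZpPow p h →ₜ* G),
      TwistHom ab.1 ab.2 | z.1 = ab}).preimage continuous_fst, fun x => Iff.rfl⟩

theorem TwistMor.continuous_comp [TopologicalSpace X] [DiscreteTopology G] : Continuous
    fun q : {q : TwistMor p h G X × TwistMor p h G X // TwistMor.dom q.1 = TwistMor.cod q.2} =>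
      TwistMor.comp q.1.1 q.1.2 q.2 := by
  classical
  have hι := TwistMor.isInducing (p := p) (h := h) (G := G) (X := X)
  refine hι.continuous_iff.2 (Continuous.prodMk ?_ ?_)
  · let D := Σ ab : (ZpPow p h →ₜ* G) × (ZpPow p h →ₜ* G), TwistHom ab.1 ab.2
    let c : D × D → D := fun z =>
      if e : z.2.1.2 = z.1.1.1 then ⟨(z.2.1.1, z.1.1.2), z.1.2.comp (z.2.2.castCod e)⟩ else z.1
    have hc : Continuous c := continuous_of_discreteTopology
    have h1 : Continuous fun q : {q : TwistMor p h G X × TwistMor p h G X //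
        TwistMor.dom q.1 = TwistMor.cod q.2} =>
        c ((⟨q.1.1.1, q.1.1.2.1⟩ : D), (⟨q.1.2.1, q.1.2.2.1⟩ : D)) :=
      hc.comp (((continuous_fst.comp hι.continuous).comp
        (continuous_fst.comp continuous_subtype_val)).prodMk
        ((continuous_fst.comp hι.continuous).comp
        (continuous_snd.comp continuous_subtype_val)))
    refine h1.congr ?_
    rintro ⟨⟨m, n⟩, e⟩
    induction m, n, e using TwistMor.composable_ind with
    | H α β δ τ τ' x => exact dif_pos rfl
  · have h2 : Continuous fun q : {q : TwistMor p h G X × TwistMor p h G X //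
        TwistMor.dom q.1 = TwistMor.cod q.2} => q.1.2 :=
      continuous_snd.comp continuous_subtype_val
    have h3 := (continuous_snd.comp hι.continuous).comp h2
    exact h3

variable (p h G) in
/-- The topological groupoid whose realization is the choice-free form of `Twist_h^G(X)`. -/
def twistGroupoid [DiscreteTopology G] (X : Type w) [TopologicalSpace X] [MulAction G X]
    [ContinuousConstSMul G X] : TopGroupoid.{max u w} where
  Obj := TwistObj p h G X
  Mor := TwistMor p h G X
  dom := TwistMor.dom
  cod := TwistMor.cod
  ident := TwistMor.ident
  inv := TwistMor.inv
  comp := TwistMor.comp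
  continuous_dom := continuous_sigma fun ab =>
    (continuous_sigmaMk (σ := fun α : ZpPow p h →ₜ* G => FixedSpace α X) (i := ab.1)).comp
      continuous_snd
  continuous_cod := continuous_sigma fun ab =>
    (continuous_sigmaMk (σ := fun α : ZpPow p h →ₜ* G => FixedSpace α X) (i := ab.2)).comp
      (TwistHom.continuous_act_prod (X := X) ab.1 ab.2)
  continuous_ident := continuous_sigma fun α =>
    (continuous_sigmaMk (σ := fun ab : (ZpPow p h →ₜ* G) × (ZpPow p h →ₜ* G) =>
      TwistHom ab.1 ab.2 × FixedSpace ab.1 X) (i := (α, α))).comp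
      (Continuous.prodMk (continuous_const (y := TwistHom.one α))
        (continuous_id (X := FixedSpace α X)))
  continuous_inv := continuous_sigma fun ab =>
    (continuous_sigmaMk (σ := fun ab : (ZpPow p h →ₜ* G) × (ZpPow p h →ₜ* G) =>
      TwistHom ab.1 ab.2 × FixedSpace ab.1 X) (i := (ab.2, ab.1))).comp
      (((TwistHom.continuous_inv ab.1 ab.2).comp continuous_fst).prodMk
        (TwistHom.continuous_act_prod (X := X) ab.1 ab.2))
  continuous_comp := TwistMor.continuous_comp
  dom_ident _ := rfl
  cod_ident x := by rw [TwistMor.cod, TwistMor.ident, TwistHom.one_act]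
  dom_inv _ := rfl
  cod_inv m := by
    simp only [TwistMor.cod, TwistMor.inv, ← TwistHom.comp_act, TwistHom.inv_comp,
      TwistHom.one_act, TwistMor.dom]
  dom_comp _ _ _ := rfl
  cod_comp m n e := by
    induction m, n, e using TwistMor.composable_ind with
    | H α β δ τ τ' x => rw [TwistMor.comp_mk]; simp only [TwistMor.cod, TwistHom.comp_act]
  comp_ident m := by
    obtain ⟨⟨α, β⟩, τ, x⟩ := m
    exact TwistMor.mk_congr (TwistHom.comp_one τ) _
  ident_comp m := by
    obtain ⟨⟨α, β⟩, τ, x⟩ := m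
    exact TwistMor.mk_congr (TwistHom.one_comp τ) _
  comp_inv m := by
    obtain ⟨⟨α, β⟩, τ, x⟩ := m
    exact TwistMor.mk_congr (TwistHom.comp_inv τ) _
  inv_comp m := by
    obtain ⟨⟨α, β⟩, τ, x⟩ := m
    exact TwistMor.mk_congr (TwistHom.inv_comp τ) _
  assoc l m n e e' := by
    obtain ⟨⟨γ, δ⟩, τ, z⟩ := l
    obtain ⟨⟨β, γ'⟩, τ', y⟩ := m
    obtain ⟨⟨α, β'⟩, τ'', x⟩ := n
    simp only [TwistMor.dom, TwistMor.cod] at e e'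
    cases e'
    cases e
    exact TwistMor.mk_congr (TwistHom.comp_assoc τ τ' τ'') _

variable (p h G) in
/-- `Twist_h^gpd(X)`: the geometric realization of the nerve of `twistGroupoid`. -/
abbrev TwistGpd [DiscreteTopology G] (X : Type w) [TopologicalSpace X] [MulAction G X]
    [ContinuousConstSMul G X] : Type (max u w) :=
  TopGroupoid.Realization (twistGroupoid p h G X)

/-! ## The comparison map for a subgroup -/

/-- The composite `i ∘ α` with the inclusion `i : H → G`. -/
def inclHom (H : Subgroup G) (α : ZpPow p h →ₜ* H) : ZpPow p h →ₜ* G where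
  toMonoidHom := H.subtype.comp (α : ZpPow p h →* H)
  continuous_toFun := continuous_subtype_val.comp (map_continuous α)

theorem inclHom_apply (H : Subgroup G) (α : ZpPow p h →ₜ* H) (j : ZpPow p h) :
    inclHom H α j = (α j : G) := rfl

theorem inclHom_mem (H : Subgroup G) {α β : ZpPow p h →ₜ* H} {g : H}
    (hg : g ∈ Conjugators α β) : (g : G) ∈ Conjugators (inclHom H α) (inclHom H β) := fun j => by
  rw [inclHom_apply, inclHom_apply, ← hg j]; rfl

/-- The map `T(α, α') → T(i ∘ α, i ∘ α')` induced by `C(α, α') → C(i ∘ α, i ∘ α')`. -/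
def TwistHom.incl (H : Subgroup G) {α β : ZpPow p h →ₜ* H} (τ : TwistHom α β) :
    TwistHom (inclHom H α) (inclHom H β) :=
  Quotient.map (sa := twistSetoid α β) (sb := twistSetoid (inclHom H α) (inclHom H β))
    (fun a => (⟨(a.1.1 : G), inclHom_mem H a.1.2⟩, a.2)) (by
      rintro a b ⟨j, h1, h2⟩
      exact ⟨j, congrArg Subtype.val h1, h2⟩) τ

theorem TwistHom.incl_comp (H : Subgroup G) {α β δ : ZpPow p h →ₜ* H} (τ : TwistHom β δ)
    (τ' : TwistHom α β) : (τ.comp τ').incl H = (τ.incl H).comp (τ'.incl H) := by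
  induction τ using ind; induction τ' using ind
  rfl

theorem TwistHom.continuous_incl [DiscreteTopology G] (H : Subgroup G) (α β : ZpPow p h →ₜ* H) :
    Continuous fun τ : TwistHom α β => τ.incl H :=
  continuous_of_discreteTopology

/-- The point `eH ∈ (G/H) ^ (im (i ∘ α))`. -/
def baseCoset (H : Subgroup G) (α : ZpPow p h →ₜ* H) : FixedSpace (inclHom H α) (G ⧸ H) :=
  ⟨((1 : G) : G ⧸ H), by
    rintro ⟨_, j, rfl⟩
    change ((α j : G) • ((1 : G) : G ⧸ H)) = ((1 : G) : G ⧸ H)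
    rw [MulAction.Quotient.smul_coe]
    exact QuotientGroup.eq.2 (by simp)⟩

theorem incl_act_baseCoset (H : Subgroup G) {α β : ZpPow p h →ₜ* H} (τ : TwistHom α β) :
    (τ.incl H).act (baseCoset H α) = baseCoset H β := by
  induction τ using TwistHom.ind with
  | H g hg t =>
    refine Subtype.ext ?_
    change (g : G) • ((1 : G) : G ⧸ H) = ((1 : G) : G ⧸ H)
    rw [MulAction.Quotient.smul_coe]
    exact QuotientGroup.eq.2 (by simp)

variable (p h) in
/-- The map of topological groupoids sending `* ∈ * ^ (im α)` to `eH ∈ (G/H) ^ (im (i ∘ α))` and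
`([g, t], *)` to `([g, t], eH)`. -/
def twistIncl [DiscreteTopology G] (H : Subgroup G) :
    TopGroupoid.Hom (twistGroupoid p h H PUnit.{u + 1}) (twistGroupoid p h G (G ⧸ H)) where
  obj x := ⟨inclHom H x.1, baseCoset H x.1⟩
  mor m := ⟨(inclHom H m.1.1, inclHom H m.1.2), (m.2.1.incl H, baseCoset H m.1.1)⟩
  continuous_obj := continuous_sigma fun α =>
    continuous_const (y := (⟨inclHom H α, baseCoset H α⟩ : TwistObj p h G (G ⧸ H)))
  continuous_mor := continuous_sigma fun ab =>
    (continuous_sigmaMk (σ := fun ab : (ZpPow p h →ₜ* G) × (ZpPow p h →ₜ* G) =>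
      TwistHom ab.1 ab.2 × FixedSpace ab.1 (G ⧸ H)) (i := (inclHom H ab.1, inclHom H ab.2))).comp
      (((TwistHom.continuous_incl H ab.1 ab.2).comp continuous_fst).prodMk
        (continuous_const (y := baseCoset H ab.1)))
  dom_mor _ := rfl
  cod_mor m := by
    change (⟨_, (m.2.1.incl H).act (baseCoset H m.1.1)⟩ : TwistObj p h G (G ⧸ H)) = _
    rw [incl_act_baseCoset]
    rfl
  mor_ident _ := rfl
  mor_comp m n e := by
    induction m, n, e using TwistMor.composable_ind with
    | H α β δ τ τ' x =>
      refine Sigma.ext rfl (heq_of_eq (Prod.ext ?_ rfl))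
      exact TwistHom.incl_comp H τ τ'

end Twist

end

/-! Every space of objects or morphisms that occurs is discrete: `G` is discrete, each `TwistHom α
β` is discrete because `α` has open kernel and `ℤ_p ^ h` is open in `ℚ_p ^ h`, and `G ⧸ H` and the
point are discrete. Hence only the algebra of ordinary groupoids remains in the first claim. A class
`[g, t]` fixing `eH` has `g ∈ H`, which gives fullness; the relations defining the twisted
Hom-spaces over `H` and over `G` use the same `j`, which gives faithfulness; and `gH` is fixed by
`im α` exactly when `g⁻¹ α g` lands in `H`, in which case `[g, 0]` carries `eH` to `gH`
(`twistIncl_isEquivalence`).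

For the second claim, an equivalence of discrete groupoids has a quasi-inverse whose two composites
with it are functors of the form `conj η`, conjugation by a choice of one morphism out of each
object (`IsEquivalence.exists_inverse`). Such a functor realizes to a map homotopic to the identity
(`conj_homotopic_id`): a simplex `σ` and its conjugate are the two halves of one simplex of twice as
many vertices, and the homotopy moves the barycentric weight from the first half to the second.

For the third claim, `Twist` and `TwistGpd` are compared for discrete `X` (`twistHomotopyEquivGpd`).
One map sends `[(t_0, …, t_n), y]` to the simplex with vertices `t_i⁻¹ y`; the other transports a
simplex to the chosen representative of its conjugacy class. One composite is the identity, the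
other is the realization of a functor `conj η`. The claim follows by combining these equivalences
for `G ⧸ H` and for the point with the second claim. -/

noncomputable section

namespace TopGroupoid

/-! ### Quotients of morphisms in a groupoid. -/

section Algebra

variable {𝒢 𝒜 ℬ 𝒞 : TopGroupoid.{u}}

/-- `comp` carries a composability proof depending on its arguments, so an argument is replaced
through this congruence rather than by rewriting. -/
theorem comp_congr {a a' b b' : 𝒢.Mor} (ha : a = a') (hb : b = b') (e : 𝒢.dom a = 𝒢.cod b)
    (e' : 𝒢.dom a' = 𝒢.cod b') : 𝒢.comp a b e = 𝒢.comp a' b' e' := by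
  subst ha hb; rfl

theorem comp_eq_left {a b : 𝒢.Mor} {x : 𝒢.Obj} (hb : b = 𝒢.ident x) (e : 𝒢.dom a = 𝒢.cod b) :
    𝒢.comp a b e = a := by
  subst hb
  obtain rfl : 𝒢.dom a = x := e.trans (𝒢.cod_ident x)
  exact 𝒢.comp_ident a

theorem comp_eq_right {a b : 𝒢.Mor} {x : 𝒢.Obj} (ha : a = 𝒢.ident x) (e : 𝒢.dom a = 𝒢.cod b) :
    𝒢.comp a b e = b := by
  subst ha
  obtain rfl : x = 𝒢.cod b := (𝒢.dom_ident x).symm.trans e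
  exact 𝒢.ident_comp b

/-- The composite `a ∘ b⁻¹` of two morphisms with the same domain. -/
def div (a b : 𝒢.Mor) (e : 𝒢.dom a = 𝒢.dom b) : 𝒢.Mor :=
  𝒢.comp a (𝒢.inv b) (e.trans (𝒢.cod_inv b).symm)

theorem dom_div (a b : 𝒢.Mor) (e : 𝒢.dom a = 𝒢.dom b) : 𝒢.dom (div a b e) = 𝒢.cod b :=
  (𝒢.dom_comp _ _ _).trans (𝒢.dom_inv b)

theorem cod_div (a b : 𝒢.Mor) (e : 𝒢.dom a = 𝒢.dom b) : 𝒢.cod (div a b e) = 𝒢.cod a :=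
  𝒢.cod_comp _ _ _

theorem div_comp (a b : 𝒢.Mor) (e : 𝒢.dom a = 𝒢.dom b) :
    𝒢.comp (div a b e) b (dom_div a b e) = a :=
  (𝒢.assoc a (𝒢.inv b) b _ (𝒢.dom_inv b)).trans (comp_eq_left (𝒢.inv_comp b) _)

theorem comp_div_self (a b : 𝒢.Mor) (e : 𝒢.dom a = 𝒢.cod b)
    (e' : 𝒢.dom (𝒢.comp a b e) = 𝒢.dom b) : div (𝒢.comp a b e) b e' = a :=
  (𝒢.assoc a b (𝒢.inv b) e (𝒢.cod_inv b).symm).trans (comp_eq_left (𝒢.comp_inv b) _)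

/-- Right cancellation of `b`. Later identities between quotients are mostly proved by multiplying
the denominator back in. -/
theorem eq_div {a b x : 𝒢.Mor} (e : 𝒢.dom a = 𝒢.dom b) (e' : 𝒢.dom x = 𝒢.cod b)
    (h : 𝒢.comp x b e' = a) : x = div a b e := by
  subst h
  exact (comp_div_self x b e' e).symm

theorem div_congr {a a' b b' : 𝒢.Mor} (ha : a = a') (hb : b = b') (e : 𝒢.dom a = 𝒢.dom b)
    (e' : 𝒢.dom a' = 𝒢.dom b') : div a b e = div a' b' e' := by
  subst ha hb; rfl

theorem div_self (a : 𝒢.Mor) (e : 𝒢.dom a = 𝒢.dom a) : div a a e = 𝒢.ident (𝒢.cod a) :=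
  𝒢.comp_inv a

theorem div_comp_div (a b c : 𝒢.Mor) (e : 𝒢.dom a = 𝒢.dom b) (e' : 𝒢.dom b = 𝒢.dom c)
    (e'' : 𝒢.dom (div a b e) = 𝒢.cod (div b c e')) :
    𝒢.comp (div a b e) (div b c e') e'' = div a c (e.trans e') := by
  refine eq_div _ ((𝒢.dom_comp _ _ _).trans (dom_div b c e')) ?_
  rw [𝒢.assoc _ _ _ _ (dom_div b c e')]
  exact (comp_congr rfl (div_comp b c e') _ (dom_div a b e)).trans (div_comp a b e)

theorem comp_div_comp (a b k : 𝒢.Mor) (ea : 𝒢.dom a = 𝒢.cod k) (eb : 𝒢.dom b = 𝒢.cod k)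
    (e : 𝒢.dom (𝒢.comp a k ea) = 𝒢.dom (𝒢.comp b k eb)) :
    div (𝒢.comp a k ea) (𝒢.comp b k eb) e = div a b (ea.trans eb.symm) := by
  refine (eq_div e ((dom_div _ _ _).trans (𝒢.cod_comp b k eb).symm) ?_).symm
  rw [← 𝒢.assoc _ _ _ (dom_div _ _ _)]
  exact comp_congr (div_comp a b _) rfl _ _

namespace Hom

@[ext]
theorem ext {F F' : Hom 𝒜 ℬ} (hobj : F.obj = F'.obj) (hmor : F.mor = F'.mor) : F = F' := by
  cases F; cases F'
  cases hobj; cases hmor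
  rfl

theorem mor_div (F : Hom 𝒜 ℬ) (a b : 𝒜.Mor) (e : 𝒜.dom a = 𝒜.dom b)
    (e' : ℬ.dom (F.mor a) = ℬ.dom (F.mor b)) :
    F.mor (div a b e) = div (F.mor a) (F.mor b) e' := by
  refine eq_div _ ?_ ?_
  · rw [F.dom_mor, F.cod_mor, dom_div]
  · rw [← F.mor_comp _ _ (dom_div a b e), div_comp]

/-- The composite of two maps of topological groupoids. -/
def comp (F' : Hom ℬ 𝒞) (F : Hom 𝒜 ℬ) : Hom 𝒜 𝒞 where
  obj := F'.obj ∘ F.obj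
  mor := F'.mor ∘ F.mor
  continuous_obj := F'.continuous_obj.comp F.continuous_obj
  continuous_mor := F'.continuous_mor.comp F.continuous_mor
  dom_mor m := by simp only [Function.comp, F'.dom_mor, F.dom_mor]
  cod_mor m := by simp only [Function.comp, F'.cod_mor, F.cod_mor]
  mor_ident x := by simp only [Function.comp, F.mor_ident, F'.mor_ident]
  mor_comp m n e := by
    simp only [Function.comp, F.mor_comp _ _ e]
    exact F'.mor_comp _ _ _

theorem realize_comp (F' : Hom ℬ 𝒞) (F : Hom 𝒜 ℬ) :
    (F'.comp F).realize = F'.realize.comp F.realize := by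
  ext z
  obtain ⟨n, σ, t⟩ := z
  rfl

end Hom

end Algebra

/-! ### Simplices of the nerve as fans of morphisms with a common source. -/

namespace Nerve

variable {𝒢 𝒜 ℬ : TopGroupoid.{u}} {n : ℕ}

instance [DiscreteTopology 𝒢.Obj] [DiscreteTopology 𝒢.Mor] : DiscreteTopology (Nerve 𝒢 n) :=
  DiscreteTopology.of_continuous_injective
    (f := fun σ : Nerve 𝒢 n => (σ.vert, σ.edge)) continuous_induced_dom
    fun _ _ h => Nerve.ext (congrArg Prod.fst h) (congrArg Prod.snd h)

/-- The simplex spanned by the codomains of morphisms with a common domain. -/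
def star (m : Fin (n + 1) → 𝒢.Mor) (hm : ∀ i j, 𝒢.dom (m i) = 𝒢.dom (m j)) : Nerve 𝒢 n where
  vert i := 𝒢.cod (m i)
  edge q := div (m q.1.2) (m q.1.1) (hm _ _)
  dom_edge _ := dom_div _ _ _
  cod_edge _ := cod_div _ _ _
  edge_refl i := div_self (m i) _
  edge_trans _ _ _ _ _ := (div_comp_div _ _ _ _ _ _).symm

theorem star_congr {m m' : Fin (n + 1) → 𝒢.Mor} (h : m = m')
    (hm : ∀ i j, 𝒢.dom (m i) = 𝒢.dom (m j)) (hm' : ∀ i j, 𝒢.dom (m' i) = 𝒢.dom (m' j)) :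
    star m hm = star m' hm' := by
  subst h; rfl

/-- A fan enters its simplex only through the quotients of its legs, and these do not see a common
right factor. This allows the base point of a fan to be moved. -/
theorem star_comp (m : Fin (n + 1) → 𝒢.Mor) (k : 𝒢.Mor) (e : ∀ i, 𝒢.dom (m i) = 𝒢.cod k)
    (hm : ∀ i j, 𝒢.dom (𝒢.comp (m i) k (e i)) = 𝒢.dom (𝒢.comp (m j) k (e j))) :
    star (fun i => 𝒢.comp (m i) k (e i)) hm = star m fun i j => (e i).trans (e j).symm :=
  Nerve.ext (funext fun _ => 𝒢.cod_comp _ _ _) (funext fun _ => comp_div_comp _ _ _ _ _ (hm _ _))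

theorem pull_star {l : ℕ} (θ : Fin (l + 1) →o Fin (n + 1)) (m : Fin (n + 1) → 𝒢.Mor)
    (hm : ∀ i j, 𝒢.dom (m i) = 𝒢.dom (m j)) :
    (star m hm).pull θ = star (fun i => m (θ i)) fun _ _ => hm _ _ := rfl

theorem push_star (F : Hom 𝒜 ℬ) (m : Fin (n + 1) → 𝒜.Mor)
    (hm : ∀ i j, 𝒜.dom (m i) = 𝒜.dom (m j)) :
    push F (star m hm) = star (fun i => F.mor (m i))
      fun i j => by rw [F.dom_mor, F.dom_mor, hm i j] :=
  Nerve.ext (funext fun _ => (F.cod_mor _).symm) (funext fun _ => F.mor_div _ _ (hm _ _)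
    (by rw [F.dom_mor, F.dom_mor, hm]))

/-- The edge from the initial vertex to the vertex `i`. -/
def spoke (σ : Nerve 𝒢 n) (i : Fin (n + 1)) : 𝒢.Mor := σ.edge ⟨(0, i), Fin.zero_le i⟩

theorem dom_spoke (σ : Nerve 𝒢 n) (i : Fin (n + 1)) : 𝒢.dom (σ.spoke i) = σ.vert 0 :=
  σ.dom_edge _

theorem cod_spoke (σ : Nerve 𝒢 n) (i : Fin (n + 1)) : 𝒢.cod (σ.spoke i) = σ.vert i :=
  σ.cod_edge _

/-- The edge from `i` to `j` is the quotient of the spokes at `j` and `i`, so identities between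
simplices reduce to identities between spokes. -/
theorem star_spoke (σ : Nerve 𝒢 n) :
    star σ.spoke (fun i j => (σ.dom_spoke i).trans (σ.dom_spoke j).symm) = σ := by
  refine Nerve.ext (funext fun i => σ.cod_spoke i) (funext ?_)
  rintro ⟨⟨i, j⟩, hij⟩
  exact (eq_div ((σ.dom_spoke j).trans (σ.dom_spoke i).symm) ((σ.dom_edge _).trans (σ.cod_spoke i).symm)
    (σ.edge_trans 0 i j (Fin.zero_le i) hij).symm).symm

/-- The initial vertex of `σ.pull θ` is the vertex `θ 0` of `σ`. The spokes therefore differ by the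
right factor `σ.spoke (θ 0)`, which `star_comp` absorbs. -/
theorem spoke_eq_comp {l : ℕ} (θ : Fin (l + 1) →o Fin (n + 1)) (σ : Nerve 𝒢 n)
    (i : Fin (l + 1)) :
    σ.spoke (θ i) = 𝒢.comp ((σ.pull θ).spoke i) (σ.spoke (θ 0))
      (((σ.pull θ).dom_spoke i).trans (σ.cod_spoke (θ 0)).symm) :=
  σ.edge_trans 0 (θ 0) (θ i) (Fin.zero_le _) (θ.monotone (Fin.zero_le i))

end Nerve

/-- The point of the realization given by a simplex and a point of the standard simplex. -/
def Realization.mk {𝒢 : TopGroupoid.{u}} {n : ℕ} (σ : Nerve 𝒢 n)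
    (t : stdSimplex ℝ (Fin (n + 1))) : Realization 𝒢 :=
  Quot.mk (Glue 𝒢) ⟨n, (σ, t)⟩

theorem Realization.mk_pull {𝒢 : TopGroupoid.{u}} {m n : ℕ} (θ : Fin (m + 1) →o Fin (n + 1))
    (σ : Nerve 𝒢 n) (t : stdSimplex ℝ (Fin (m + 1))) :
    mk (σ.pull θ) t = mk σ (stdSimplex.map θ t) :=
  Quot.sound (Glue.mk θ σ t)

theorem Realization.continuous_mk {𝒢 : TopGroupoid.{u}} {n : ℕ} :
    Continuous fun z : Nerve 𝒢 n × stdSimplex ℝ (Fin (n + 1)) => mk z.1 z.2 :=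
  continuous_quot_mk.comp (continuous_sigmaMk
    (σ := fun n => Nerve 𝒢 n × stdSimplex ℝ (Fin (n + 1))))

theorem Realization.continuous_mk_right {𝒢 : TopGroupoid.{u}} {n : ℕ} (σ : Nerve 𝒢 n) :
    Continuous (mk σ) :=
  continuous_mk.comp (continuous_const.prodMk continuous_id)

end TopGroupoid

/-! ## Doubling of simplices -/

section Doubling

/-- The point `(1 - s) t + s t'` of the standard simplex. -/
def stdSimplex.mix {ι : Type*} [Fintype ι] (s : unitInterval) (t t' : stdSimplex ℝ ι) :
    stdSimplex ℝ ι :=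
  ⟨(1 - (s : ℝ)) • (t : ι → ℝ) + (s : ℝ) • (t' : ι → ℝ),
    convex_stdSimplex ℝ ι t.2 t'.2 (sub_nonneg.2 s.2.2) s.2.1 (sub_add_cancel 1 _)⟩

theorem stdSimplex.mix_zero {ι : Type*} [Fintype ι] (t t' : stdSimplex ℝ ι) :
    mix 0 t t' = t := by
  ext i
  change (1 - (0 : ℝ)) * t i + 0 * t' i = t i
  ring

theorem stdSimplex.mix_one {ι : Type*} [Fintype ι] (t t' : stdSimplex ℝ ι) :
    mix 1 t t' = t' := by
  ext i
  change (1 - (1 : ℝ)) * t i + 1 * t' i = t' i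
  ring

theorem stdSimplex.map_mix {ι κ : Type*} [Fintype ι] [Fintype κ] (f : ι → κ) (s : unitInterval)
    (t t' : stdSimplex ℝ ι) : map f (mix s t t') = mix s (map f t) (map f t') := by
  ext i
  -- The pushforward of points of the simplex is the restriction of a linear map.
  change FunOnFinite.linearMap ℝ ℝ f ((1 - (s : ℝ)) • (t : ι → ℝ) + (s : ℝ) • (t' : ι → ℝ)) i = _
  rw [map_add, map_smul, map_smul]
  rfl

theorem stdSimplex.continuous_mix {ι : Type*} [Fintype ι] :
    Continuous fun z : unitInterval × (stdSimplex ℝ ι × stdSimplex ℝ ι) =>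
      mix z.1 z.2.1 z.2.2 := by
  refine Continuous.subtype_mk ?_ _
  fun_prop

variable {m n : ℕ}

/-- The inclusion of `[n]` as the first half of `[n] ⊔ [n] = [2 n + 1]`. -/
def finLeft (n : ℕ) : Fin (n + 1) →o Fin (n + 1 + n + 1) where
  -- `n + 1 + n + 1` is the number of vertices of a simplex of dimension `n + 1 + n`, and is
  -- definitionally `(n + 1) + (n + 1)`.
  toFun := Fin.castAdd (n + 1)
  monotone' _ _ h := h

/-- The inclusion of `[n]` as the second half of `[n] ⊔ [n] = [2 n + 1]`. -/
def finRight (n : ℕ) : Fin (n + 1) →o Fin (n + 1 + n + 1) where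
  toFun := Fin.natAdd (n + 1)
  monotone' _ _ h := Nat.add_le_add_left h (n + 1)

/-- The function on `[2 n + 1]` with given restrictions to the two halves. -/
def finElim {A : Type*} (f g : Fin (n + 1) → A) (i : Fin (n + 1 + n + 1)) : A :=
  Fin.addCases (m := n + 1) (n := n + 1) (motive := fun _ => A) f g i

theorem finElim_left {A : Type*} (f g : Fin (n + 1) → A) (i : Fin (n + 1)) :
    finElim f g (finLeft n i) = f i :=
  Fin.addCases_left (m := n + 1) (n := n + 1) (motive := fun _ => A) i

theorem finElim_right {A : Type*} (f g : Fin (n + 1) → A) (i : Fin (n + 1)) :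
    finElim f g (finRight n i) = g i :=
  Fin.addCases_right (m := n + 1) (n := n + 1) (motive := fun _ => A) i

theorem fin_double_cases {P : Fin (n + 1 + n + 1) → Prop} (hl : ∀ i, P (finLeft n i))
    (hr : ∀ i, P (finRight n i)) (i : Fin (n + 1 + n + 1)) : P i :=
  Fin.addCases (m := n + 1) (n := n + 1) (motive := P) hl hr i

/-- The monotone map `θ ⊔ θ : [2 m + 1] → [2 n + 1]`. -/
def finDouble (θ : Fin (m + 1) →o Fin (n + 1)) :
    Fin (m + 1 + m + 1) →o Fin (n + 1 + n + 1) where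
  toFun := finElim (fun i => finLeft n (θ i)) (fun i => finRight n (θ i))
  monotone' i j := by
    induction i using fin_double_cases with
    | hl i =>
      induction j using fin_double_cases with
      | hl j =>
        intro h
        rw [finElim_left, finElim_left]
        exact (finLeft n).monotone (θ.monotone h)
      | hr j =>
        intro _
        rw [finElim_left, finElim_right]
        change (θ i : ℕ) ≤ n + 1 + (θ j : ℕ)
        have := (θ i).2
        omega
    | hr i =>
      induction j using fin_double_cases with
      | hl j =>
        intro h
        -- This case is void: an index of the second half exceeds every index of the first.
        have h' : m + 1 + (i : ℕ) ≤ (j : ℕ) := h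
        have := j.2
        omega
      | hr j =>
        intro h
        rw [finElim_right, finElim_right]
        have h' : m + 1 + (i : ℕ) ≤ m + 1 + (j : ℕ) := h
        exact (finRight n).monotone (θ.monotone (show (i : ℕ) ≤ j by omega))

theorem finDouble_left (θ : Fin (m + 1) →o Fin (n + 1)) (i : Fin (m + 1)) :
    finDouble θ (finLeft m i) = finLeft n (θ i) :=
  finElim_left (fun i => finLeft n (θ i)) (fun i => finRight n (θ i)) i

theorem finDouble_right (θ : Fin (m + 1) →o Fin (n + 1)) (i : Fin (m + 1)) :
    finDouble θ (finRight m i) = finRight n (θ i) :=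
  finElim_right (fun i => finLeft n (θ i)) (fun i => finRight n (θ i)) i

/-- The point `((1 - s) t, s t)` of the standard simplex of dimension `2 n + 1`. -/
def blend (s : unitInterval) (t : stdSimplex ℝ (Fin (n + 1))) :
    stdSimplex ℝ (Fin (n + 1 + n + 1)) :=
  stdSimplex.mix s (stdSimplex.map (finLeft n) t) (stdSimplex.map (finRight n) t)

/-- Together with `pull_double`, this makes the homotopy compatible with the gluing relation. -/
theorem map_finDouble_blend (θ : Fin (m + 1) →o Fin (n + 1)) (s : unitInterval)
    (t : stdSimplex ℝ (Fin (m + 1))) :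
    stdSimplex.map (finDouble θ) (blend s t) = blend s (stdSimplex.map θ t) := by
  rw [blend, blend, stdSimplex.map_mix]
  simp only [stdSimplex.map_comp_apply]
  congr 2
  · exact funext fun i => finDouble_left θ i
  · exact funext fun i => finDouble_right θ i

theorem continuous_blend : Continuous fun z : stdSimplex ℝ (Fin (n + 1)) × unitInterval =>
    blend z.2 z.1 :=
  stdSimplex.continuous_mix.comp (continuous_snd.prodMk
    (((stdSimplex.continuous_map _).comp continuous_fst).prodMk
      ((stdSimplex.continuous_map _).comp continuous_fst)))

end Doubling

namespace TopGroupoid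

/-! ## Conjugation by a family of morphisms is homotopic to the identity -/

section Conjugation

variable {𝒢 : TopGroupoid.{u}}
variable (η : 𝒢.Obj → 𝒢.Mor) (hη : ∀ x, 𝒢.dom (η x) = x)

/-- The edges from the initial vertex of `σ` to the vertices of `σ` and of its conjugate. -/
def doubleSpoke {n : ℕ} (σ : Nerve 𝒢 n) : Fin (n + 1 + n + 1) → 𝒢.Mor :=
  finElim σ.spoke fun i => 𝒢.comp (η (σ.vert i)) (σ.spoke i) ((hη _).trans (σ.cod_spoke i).symm)

theorem dom_doubleSpoke {n : ℕ} (σ : Nerve 𝒢 n) (i : Fin (n + 1 + n + 1)) :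
    𝒢.dom (doubleSpoke η hη σ i) = σ.vert 0 := by
  induction i using fin_double_cases with
  | hl i => rw [doubleSpoke, finElim_left, σ.dom_spoke]
  | hr i => rw [doubleSpoke, finElim_right, 𝒢.dom_comp, σ.dom_spoke]

/-- The simplex spanned by the vertices of `σ` followed by those of its conjugate. -/
def double {n : ℕ} (σ : Nerve 𝒢 n) : Nerve 𝒢 (n + 1 + n) :=
  Nerve.star (doubleSpoke η hη σ) fun i j =>
    (dom_doubleSpoke η hη σ i).trans (dom_doubleSpoke η hη σ j).symm

theorem pull_double {m n : ℕ} (θ : Fin (m + 1) →o Fin (n + 1)) (σ : Nerve 𝒢 n) :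
    (double η hη σ).pull (finDouble θ) = double η hη (σ.pull θ) := by
  have e : ∀ i, 𝒢.dom (doubleSpoke η hη (σ.pull θ) i) = 𝒢.cod (σ.spoke (θ 0)) := fun i =>
    (dom_doubleSpoke η hη (σ.pull θ) i).trans (σ.cod_spoke (θ 0)).symm
  -- The fan on the right is rebased from the vertex `θ 0` of `σ` to the vertex `0`; then the legs
  -- agree one by one.
  refine Eq.trans ?_ (Nerve.star_comp _ _ e fun i j => by simp only [𝒢.dom_comp])
  rw [double, Nerve.pull_star]
  refine Nerve.star_congr (funext fun i => ?_) _ _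
  induction i using fin_double_cases with
  | hl i =>
    rw [finDouble_left, doubleSpoke, finElim_left]
    exact (σ.spoke_eq_comp θ i).trans (comp_congr (finElim_left _ _ i).symm rfl _ _)
  | hr i =>
    rw [finDouble_right, doubleSpoke, finElim_right]
    refine Eq.trans ?_ (comp_congr (finElim_right _ _ i).symm rfl
      ((𝒢.dom_comp _ _ _).trans (((σ.pull θ).dom_spoke i).trans (σ.cod_spoke (θ 0)).symm)) _)
    rw [𝒢.assoc _ _ _ _ (((σ.pull θ).dom_spoke i).trans (σ.cod_spoke (θ 0)).symm)]
    exact comp_congr rfl (σ.spoke_eq_comp θ i) _ _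

theorem pull_finLeft_double {n : ℕ} (σ : Nerve 𝒢 n) :
    (double η hη σ).pull (finLeft n) = σ := by
  refine Eq.trans ?_ σ.star_spoke
  rw [double, Nerve.pull_star]
  exact Nerve.star_congr (funext fun i => finElim_left _ _ i) _ _

variable [DiscreteTopology 𝒢.Obj] [DiscreteTopology 𝒢.Mor]

/-- The functor that sends `x` to the codomain of `η x` and conjugates morphisms by `η`. -/
def conj : Hom 𝒢 𝒢 where
  obj x := 𝒢.cod (η x)
  mor m := div (𝒢.comp (η (𝒢.cod m)) m (hη _)) (η (𝒢.dom m))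
    ((𝒢.dom_comp _ _ _).trans (hη _).symm)
  continuous_obj := continuous_of_discreteTopology
  continuous_mor := continuous_of_discreteTopology
  dom_mor _ := dom_div _ _ _
  cod_mor _ := (cod_div _ _ _).trans (𝒢.cod_comp _ _ _)
  mor_ident x := by
    refine (eq_div _ ((𝒢.dom_ident _).trans (by rw [𝒢.dom_ident])) ?_).symm
    rw [comp_eq_right rfl, comp_eq_left rfl, 𝒢.dom_ident, 𝒢.cod_ident]
  mor_comp m n e := by
    have hm : 𝒢.dom (𝒢.comp (η (𝒢.cod m)) m (hη _)) = 𝒢.dom (η (𝒢.dom m)) :=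
      (𝒢.dom_comp _ _ _).trans (hη _).symm
    -- After multiplication by the last `η`, the product `(η m η⁻¹)(η n η⁻¹)` must give `η m n`; the
    -- inner factors cancel at the object `dom m = cod n`.
    refine (eq_div _ ?_ ?_).symm
    · rw [𝒢.dom_comp, dom_div, 𝒢.dom_comp]
    · have h1 : 𝒢.dom (𝒢.comp (η (𝒢.cod n)) n (hη _)) = 𝒢.dom (η (𝒢.dom n)) :=
        (𝒢.dom_comp _ _ _).trans (hη _).symm
      have h2 : 𝒢.dom (div (𝒢.comp (η (𝒢.cod m)) m (hη _)) (η (𝒢.dom m)) hm) =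
          𝒢.cod (div (𝒢.comp (η (𝒢.cod n)) n (hη _)) (η (𝒢.dom n)) h1) := by
        rw [dom_div, cod_div, 𝒢.cod_comp, e]
      have h3 : 𝒢.comp (η (𝒢.cod (𝒢.comp m n e))) (𝒢.comp m n e) (hη _) =
          𝒢.comp (𝒢.comp (η (𝒢.cod m)) m (hη _)) n ((𝒢.dom_comp _ _ _).trans e) := by
        rw [𝒢.assoc _ _ _ _ e]
        exact comp_congr (by rw [𝒢.cod_comp]) rfl _ _
      rw [h3]
      have h4 : 𝒢.comp (𝒢.comp (div (𝒢.comp (η (𝒢.cod m)) m (hη _)) (η (𝒢.dom m)) hm)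
          (div (𝒢.comp (η (𝒢.cod n)) n (hη _)) (η (𝒢.dom n)) h1) h2) (η (𝒢.dom n))
          ((𝒢.dom_comp _ _ _).trans (dom_div _ _ _)) =
          𝒢.comp (𝒢.comp (η (𝒢.cod m)) m (hη _)) n ((𝒢.dom_comp _ _ _).trans e) := by
        rw [𝒢.assoc _ _ _ _ (dom_div _ _ _)]
        refine (comp_congr rfl (div_comp _ _ h1) _
          (by rw [dom_div, 𝒢.cod_comp, e])).trans ?_
        rw [← 𝒢.assoc _ _ _ (by rw [dom_div, e])]
        refine comp_congr ?_ rfl _ _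
        exact (comp_congr rfl (by rw [e]) _ (dom_div _ _ _)).trans (div_comp _ _ hm)
      refine Eq.trans (comp_congr rfl ?_ _ ?_) h4
      · rw [𝒢.dom_comp]
      · rw [𝒢.dom_comp, dom_div]

/-- The right-hand legs are `η_i ∘ spoke_i`, while the spokes of the conjugate simplex are `η_i ∘
spoke_i ∘ η_0⁻¹`. The common factor `η_0⁻¹` does not change the simplex. -/
theorem pull_finRight_double {n : ℕ} (σ : Nerve 𝒢 n) :
    (double η hη σ).pull (finRight n) = Nerve.push (conj η hη) σ := by
  conv_rhs => rw [← σ.star_spoke, Nerve.push_star]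
  have e : ∀ i, 𝒢.dom (𝒢.comp (η (σ.vert i)) (σ.spoke i)
      ((hη _).trans (σ.cod_spoke i).symm)) = 𝒢.cod (𝒢.inv (η (σ.vert 0))) := fun i => by
    rw [𝒢.dom_comp, σ.dom_spoke, 𝒢.cod_inv, hη]
  refine Eq.trans ?_ ((Nerve.star_comp _ _ e fun i j => by simp only [𝒢.dom_comp]).symm.trans ?_)
  · rw [double, Nerve.pull_star]
    exact Nerve.star_congr (funext fun i => finElim_right _ _ i) _ _
  · refine Nerve.star_congr (funext fun i => comp_congr ?_ ?_ _ _) _ _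
    · exact comp_congr (by rw [σ.cod_spoke]) rfl _ _
    · rw [σ.dom_spoke]

/-- The homotopy on simplices, `(σ, t), s ↦ (σ ⊔ σ^η, ((1 - s) t, s t))`. -/
def conjPath : C(Realization 𝒢, C(unitInterval, Realization 𝒢)) where
  toFun := Quot.lift (fun z => ⟨fun s => Realization.mk (double η hη z.2.1) (blend s z.2.2),
      Realization.continuous_mk.comp (continuous_const.prodMk
        (continuous_blend.comp (continuous_const.prodMk continuous_id)))⟩) (by
    rintro _ _ ⟨θ, σ, t⟩
    refine ContinuousMap.ext fun s => ?_
    change Realization.mk (double η hη (σ.pull θ)) (blend s t) =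
      Realization.mk (double η hη σ) (blend s (stdSimplex.map θ t))
    rw [← map_finDouble_blend, ← Realization.mk_pull, pull_double])
  continuous_toFun := by
    -- With values in a path space, continuity can be checked before passing to the quotient,
    -- without asking whether the quotient map times the interval is again a quotient map.
    -- Discreteness of the nerve makes `double` continuous.
    refine continuous_quot_lift _ (continuous_sigma fun n => ?_)
    refine ContinuousMap.continuous_of_continuous_uncurry _ ?_
    exact Realization.continuous_mk.comp
      (((continuous_of_discreteTopology (f := double η hη (n := n))).comp
        (continuous_fst.comp continuous_fst)).prodMk
        (continuous_blend.comp ((continuous_snd.comp continuous_fst).prodMk continuous_snd)))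

/-- At time `0` all weight lies on the left half, which is `σ`; at time `1` on the right half, which
is its conjugate. -/
theorem conj_homotopic_id :
    (conj η hη).realize.Homotopic (ContinuousMap.id (Realization 𝒢)) := by
  refine ContinuousMap.Homotopic.symm ⟨⟨⟨fun z => conjPath η hη z.2 z.1, ?_⟩, ?_, ?_⟩⟩
  · exact (ContinuousMap.continuous_uncurry_of_continuous (conjPath η hη)).comp continuous_swap
  · rintro ⟨n, σ, t⟩
    change Realization.mk (double η hη σ) (blend 0 t) = Realization.mk σ t
    rw [blend, stdSimplex.mix_zero, ← Realization.mk_pull, pull_finLeft_double]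
  · rintro ⟨n, σ, t⟩
    change Realization.mk (double η hη σ) (blend 1 t) =
      Realization.mk (Nerve.push (conj η hη) σ) t
    rw [blend, stdSimplex.mix_one, ← Realization.mk_pull, pull_finRight_double]

end Conjugation

end TopGroupoid

namespace TopGroupoid

/-! ## Equivalences of discrete groupoids -/

namespace Hom

variable {𝒜 ℬ : TopGroupoid.{u}} {F : Hom 𝒜 ℬ}

theorem FullyFaithful.mor_injective (hF : F.FullyFaithful) {m m' : 𝒜.Mor}
    (hd : 𝒜.dom m = 𝒜.dom m') (hc : 𝒜.cod m = 𝒜.cod m') (h : F.mor m = F.mor m') : m = m' :=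
  hF.bijective.1 (Subtype.ext (Prod.ext h (Prod.ext hd hc)))

theorem FullyFaithful.exists_mor (hF : F.FullyFaithful) {x y : 𝒜.Obj} {m : ℬ.Mor}
    (hd : ℬ.dom m = F.obj x) (hc : ℬ.cod m = F.obj y) :
    ∃ m' : 𝒜.Mor, F.mor m' = m ∧ 𝒜.dom m' = x ∧ 𝒜.cod m' = y := by
  obtain ⟨m', h⟩ := hF.bijective.2 ⟨(m, (x, y)), Prod.ext hd hc⟩
  have h' := congrArg Subtype.val h
  exact ⟨m', congrArg (fun q => q.1) h', congrArg (fun q => q.2.1) h',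
    congrArg (fun q => q.2.2) h'⟩

/-- Only the value of the local section at `y` is kept. It is inverted so that its domain is `y`,
the direction that `conj` requires. -/
theorem EssSurjective.exists_mor (hF : F.EssSurjective) (y : ℬ.Obj) :
    ∃ (m : ℬ.Mor) (x : 𝒜.Obj), ℬ.dom m = y ∧ ℬ.cod m = F.obj x := by
  obtain ⟨U, -, hy, s, -, hs⟩ := hF y
  exact ⟨ℬ.inv (s ⟨y, hy⟩).1.1, (s ⟨y, hy⟩).1.2, (ℬ.dom_inv _).trans (hs ⟨y, hy⟩),
    (ℬ.cod_inv _).trans (s ⟨y, hy⟩).2⟩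

variable [DiscreteTopology 𝒜.Obj] [DiscreteTopology 𝒜.Mor]
variable [DiscreteTopology ℬ.Obj] [DiscreteTopology ℬ.Mor]

/-- The usual quasi-inverse by choice: `η y` goes from `y` to some `F (s y)`, `k m` is the lift of
`η m η⁻¹`, and `ε x` is the lift of `η (F x)`. Functoriality of the lifts is checked after applying
`F`, and continuity is automatic by discreteness. -/
theorem IsEquivalence.exists_inverse (hF : F.IsEquivalence) :
    ∃ (K : Hom ℬ 𝒜) (η : ℬ.Obj → ℬ.Mor) (hη : ∀ y, ℬ.dom (η y) = y)
      (ε : 𝒜.Obj → 𝒜.Mor) (hε : ∀ x, 𝒜.dom (ε x) = x),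
      F.comp K = conj η hη ∧ K.comp F = conj ε hε := by
  obtain ⟨hff, hes⟩ := hF
  choose η s hη hs using fun y => hes.exists_mor y
  choose k hk hkd hkc using fun m : ℬ.Mor => hff.exists_mor
    (((conj η hη).dom_mor m).trans (hs _)) (((conj η hη).cod_mor m).trans (hs _))
  choose ε hFε hεd hεc using fun x : 𝒜.Obj => hff.exists_mor (hη (F.obj x)) (hs (F.obj x))
  let K : Hom ℬ 𝒜 :=
    { obj := s
      mor := k
      continuous_obj := continuous_of_discreteTopology
      continuous_mor := continuous_of_discreteTopology
      dom_mor := hkd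
      cod_mor := hkc
      mor_ident := fun y => by
        refine hff.mor_injective ?_ ?_ ?_
        · rw [hkd, ℬ.dom_ident, 𝒜.dom_ident]
        · rw [hkc, ℬ.cod_ident, 𝒜.cod_ident]
        · rw [hk, (conj η hη).mor_ident, F.mor_ident]
          exact congrArg ℬ.ident (hs y)
      mor_comp := fun m n e => by
        have e' : 𝒜.dom (k m) = 𝒜.cod (k n) := by rw [hkd, hkc, e]
        refine hff.mor_injective ?_ ?_ ?_
        · rw [hkd, ℬ.dom_comp, 𝒜.dom_comp, hkd]
        · rw [hkc, ℬ.cod_comp, 𝒜.cod_comp, hkc]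
        · rw [hk, (conj η hη).mor_comp m n e, F.mor_comp _ _ e']
          exact comp_congr (hk m).symm (hk n).symm _ _ }
  refine ⟨K, η, hη, ε, hεd, ?_, ?_⟩
  · exact Hom.ext (funext fun y => (hs y).symm) (funext fun m => hk m)
  · refine Hom.ext (funext fun x => (hεc x).symm) (funext fun m => hff.mor_injective ?_ ?_ ?_)
    · rw [(K.comp F).dom_mor, (conj ε hεd).dom_mor]
      exact (hεc _).symm
    · rw [(K.comp F).cod_mor, (conj ε hεd).cod_mor]
      exact (hεc _).symm
    -- Under `F` both morphisms become the conjugate of `F m` by `η`, since `F (ε x) = η (F x)`.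
    · refine (hk (F.mor m)).trans ?_
      have e := (F.dom_mor (𝒜.comp (ε (𝒜.cod m)) m (hεd _))).trans
        ((congrArg F.obj ((𝒜.dom_comp _ _ _).trans (hεd _).symm)).trans (F.dom_mor _).symm)
      refine Eq.trans (div_congr ?_ ?_ ((ℬ.dom_comp _ _ _).trans (hη _).symm) e)
        (F.mor_div _ _ ((𝒜.dom_comp _ _ _).trans (hεd _).symm) e).symm
      · rw [F.mor_comp]
        exact comp_congr (by rw [hFε, F.cod_mor]) rfl _ _
      · rw [hFε, F.dom_mor]

/-- An equivalence of discrete groupoids induces a homotopy equivalence of realizations. -/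
theorem IsEquivalence.exists_homotopyEquiv (hF : F.IsEquivalence) :
    ∃ e : Realization 𝒜 ≃ₕ Realization ℬ, e.toFun = F.realize := by
  obtain ⟨K, η, hη, ε, hε, hFK, hKF⟩ := hF.exists_inverse
  refine ⟨⟨F.realize, K.realize, ?_, ?_⟩, rfl⟩
  · rw [← realize_comp, hKF]
    exact conj_homotopic_id ε hε
  · rw [← realize_comp, hFK]
    exact conj_homotopic_id η hη

end Hom

end TopGroupoid

open TopGroupoid

/-! ## Simplices of chaotic groupoids -/

section Chaotic

variable {T : Type u} [TopologicalSpace T] {n : ℕ}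

/-- The simplex of a chaotic groupoid with given vertices. -/
def chaoticSimplex (f : Fin (n + 1) → T) : Nerve (chaoticGroupoid T) n where
  vert := f
  edge q := (f q.1.1, f q.1.2)
  dom_edge _ := rfl
  cod_edge _ := rfl
  edge_refl _ := rfl
  edge_trans _ _ _ _ _ := rfl

theorem chaoticSimplex_vert (σ : Nerve (chaoticGroupoid T) n) : chaoticSimplex σ.vert = σ :=
  Nerve.ext rfl (funext fun q => Prod.ext (σ.dom_edge q).symm (σ.cod_edge q).symm)

/-- The class of a point of `ET × Y` in the Borel construction. -/
def BorelConstruction.mk {T : Type u} [TopologicalSpace T] [Group T] [IsTopologicalGroup T]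
    {Y : Type v} [TopologicalSpace Y] [MulAction T Y] (z : UniversalSpace T × Y) :
    BorelConstruction T Y :=
  Quot.mk _ z

theorem BorelConstruction.continuous_mk {T : Type u} [TopologicalSpace T] [Group T]
    [IsTopologicalGroup T] {Y : Type v} [TopologicalSpace Y] [MulAction T Y] :
    Continuous (mk : UniversalSpace T × Y → BorelConstruction T Y) :=
  continuous_quot_mk

end Chaotic

section TwistComparison

variable {p : ℕ} [Fact p.Prime] {h : ℕ}
variable {G : Type u} [Group G] [TopologicalSpace G]

/-! ## Transport to the chosen representatives of conjugacy classes -/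

section Representatives

variable {X : Type u} [MulAction G X]

/-- A morphism from `α` to the chosen representative of its conjugacy class, which is the identity
if `α` is that representative. -/
def toRep (c : Quotient (conjSetoid p h G)) (α : ZpPow p h →ₜ* G)
    (e : Quotient.mk (conjSetoid p h G) α = c) : TwistHom α c.out :=
  open scoped Classical in
  if hα : α = c.out then TwistHom.castCod hα (TwistHom.one α)
  else TwistHom.mk _ (Quotient.exact (e.trans c.out_eq.symm)).choose_spec 0

/-- This normalization makes `gpdToTwist` a strict left inverse of `twistToGpd`. -/
theorem toRep_out (c : Quotient (conjSetoid p h G)) : toRep c c.out c.out_eq = 1 :=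
  dif_pos rfl

theorem TwistHom.conjugate_comp_self {α β γ δ : ZpPow p h →ₜ* G} (a : TwistHom γ δ)
    (b : TwistHom β γ) (k : TwistHom β α) : ((a.comp (b.comp k.inv)).comp k) = a.comp b := by
  rw [comp_assoc, comp_assoc, TwistHom.inv_comp, comp_one]

theorem TwistHom.comp_conjugate {α β γ δ ε ζ : ZpPow p h →ₜ* G} (a : TwistHom δ ε)
    (τ : TwistHom γ δ) (b : TwistHom γ ζ) (τ' : TwistHom β γ) (k : TwistHom β α) :
    a.comp ((τ.comp τ').comp k.inv) =
      (a.comp (τ.comp b.inv)).comp (b.comp (τ'.comp k.inv)) := by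
  rw [← comp_assoc _ b, conjugate_comp_self]
  simp only [comp_assoc]

/-- The conjugacy class of the homomorphism underlying an object. -/
def objClass (x : TwistObj p h G X) : Quotient (conjSetoid p h G) :=
  Quotient.mk (conjSetoid p h G) x.1

theorem objClass_cod (m : TwistMor p h G X) : objClass m.cod = objClass m.dom := by
  obtain ⟨⟨α, β⟩, τ, x⟩ := m
  induction τ using TwistHom.ind with
  | H g hg t => exact (Quotient.sound (s := conjSetoid p h G) ⟨g, hg⟩).symm

variable (c : Quotient (conjSetoid p h G))

/-- The transport of an object to the chosen representative. -/
def objRep (x : TwistObj p h G X) (e : objClass x = c) : FixedSpace c.out X :=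
  (toRep c x.1 e).act x.2

/-- The transport of a morphism to the chosen representative. -/
def morRep (m : TwistMor p h G X) (e : objClass m.dom = c) : TwistHom c.out c.out :=
  (toRep c m.1.2 ((objClass_cod m).trans e)).comp (m.2.1.comp (toRep c m.1.1 e).inv)

theorem morRep_comp (m n : TwistMor p h G X) (e : m.dom = n.cod) (hm : objClass m.dom = c)
    (hn : objClass n.dom = c) :
    morRep c (TwistMor.comp m n e) hn = morRep c m hm * morRep c n hn := by
  induction m, n, e using TwistMor.composable_ind with
  | H α β δ τ τ' x =>
    change TwistHom.comp _ (TwistHom.comp (TwistHom.comp τ τ') _) =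
      TwistHom.comp (TwistHom.comp _ (TwistHom.comp τ _))
        (TwistHom.comp _ (TwistHom.comp τ' _))
    exact TwistHom.comp_conjugate _ _ _ _ _

/-- Both sides transport the codomain of `m`, since `toRep` at the source cancels. The ends `x`, `y`
are free variables because the ends of an edge in a nerve agree with its vertices only
propositionally. -/
theorem morRep_smul (m : TwistMor p h G X) {x y : TwistObj p h G X} (hx : m.dom = x)
    (hy : m.cod = y) (e : objClass m.dom = c) (ex : objClass x = c) (ey : objClass y = c) :
    morRep c m e • objRep c x ex = objRep c y ey := by
  subst hx hy
  change (morRep c m e).act ((toRep c m.1.1 ex).act m.2.2) =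
    (toRep c m.1.2 ey).act (m.2.1.act m.2.2)
  rw [← TwistHom.comp_act, ← TwistHom.comp_act, morRep, TwistHom.comp_assoc,
    TwistHom.comp_assoc, TwistHom.inv_comp, TwistHom.comp_one]

/-- The morphism from an object to its transport. -/
def repMor (x : TwistObj p h G X) (e : objClass x = c) : TwistMor p h G X :=
  ⟨(x.1, c.out), (toRep c x.1 e, x.2)⟩

/-- Naturality square of the transport; it identifies conjugation by `repMor` with `morRep`. -/
theorem comp_repMor (m : TwistMor p h G X) (e : objClass m.dom = c)
    (e' : TwistMor.dom (⟨(c.out, c.out), (morRep c m e, objRep c m.dom e)⟩ : TwistMor p h G X) =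
      (repMor c m.dom e).cod) :
    TwistMor.comp ⟨(c.out, c.out), (morRep c m e, objRep c m.dom e)⟩ (repMor c m.dom e) e' =
      TwistMor.comp (repMor c m.cod ((objClass_cod m).trans e)) m rfl := by
  refine TwistMor.mk_congr ?_ _
  change TwistHom.comp (TwistHom.comp _ (TwistHom.comp m.2.1 _)) _ = TwistHom.comp _ m.2.1
  exact TwistHom.conjugate_comp_self _ _ _

end Representatives

variable [DiscreteTopology G]
variable {X : Type u} [TopologicalSpace X] [MulAction G X]
variable [ContinuousConstSMul G X]

/-! ## The maps between `Twist` and the realization -/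

/-- The functor `t ↦ t⁻¹ y` from the chaotic groupoid of `T(α)`. -/
def orbitHom (α : ZpPow p h →ₜ* G) (y : FixedSpace α X) :
    Hom (chaoticGroupoid (TwistHom α α)) (twistGroupoid p h G X) where
  obj := fun t : TwistHom α α => (⟨α, t⁻¹ • y⟩ : TwistObj p h G X)
  mor := fun m : TwistHom α α × TwistHom α α =>
    (⟨(α, α), (m.2⁻¹ * m.1, m.1⁻¹ • y)⟩ : TwistMor p h G X)
  continuous_obj := continuous_of_discreteTopology (α := TwistHom α α)
  continuous_mor := continuous_of_discreteTopology (α := TwistHom α α × TwistHom α α)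
  dom_mor _ := rfl
  cod_mor := by
    rintro ⟨(a : TwistHom α α), (b : TwistHom α α)⟩
    refine congrArg (Sigma.mk α) (?_ : (b⁻¹ * a) • a⁻¹ • y = b⁻¹ • y)
    rw [smul_smul, mul_inv_cancel_right]
  mor_ident t := TwistMor.mk_congr (inv_mul_cancel (G := TwistHom α α) t) _
  mor_comp := by
    rintro ⟨t, a⟩ ⟨b, t'⟩ e
    obtain rfl : t = t' := e
    refine TwistMor.mk_congr (?_ : a⁻¹ * b = (a⁻¹ * t) * (t⁻¹ * b)) _
    rw [mul_assoc, mul_inv_cancel_left]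

/-- `(a t)⁻¹ (a y) = t⁻¹ y`: the inverse in `orbitHom` is there so that the construction descends to
the orbit space of the diagonal action. -/
theorem orbitHom_smul (α : ZpPow p h →ₜ* G) (a : TwistHom α α) (y : FixedSpace α X) :
    (orbitHom α (a • y)).comp (chaoticTranslate a) = orbitHom α y := by
  refine Hom.ext (funext fun t => ?_) (funext fun m => ?_)
  · change TwistHom α α at t
    refine congrArg (Sigma.mk α) (?_ : (a * t)⁻¹ • a • y = t⁻¹ • y)
    rw [smul_smul, mul_inv_rev, inv_mul_cancel_right]
  · change TwistHom α α × TwistHom α α at m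
    refine congrArg (Sigma.mk (α, α)) (Prod.ext
      (?_ : (a * m.2)⁻¹ * (a * m.1) = m.2⁻¹ * m.1) (?_ : (a * m.1)⁻¹ • a • y = m.1⁻¹ • y))
    · group
    · rw [smul_smul, mul_inv_rev, inv_mul_cancel_right]

theorem objClass_vert {n : ℕ} (σ : Nerve (twistGroupoid p h G X) n) (i : Fin (n + 1)) :
    objClass (σ.vert i) = objClass (σ.vert 0) :=
  (congrArg objClass (σ.cod_spoke i)).symm.trans
    ((objClass_cod (σ.spoke i)).trans (congrArg objClass (σ.dom_spoke i)))

/-- The class in `ET ×_T X ^ (im α)` of a simplex and a point of the standard simplex. -/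
def borelPoint {n : ℕ} (σ : Nerve (twistGroupoid p h G X) n) (t : stdSimplex ℝ (Fin (n + 1)))
    (c : Quotient (conjSetoid p h G)) (e : objClass (σ.vert 0) = c) : Twist p h G X :=
  -- With `y` the transport of the vertex `0`, the group elements `t_i` are chosen so that `t_i⁻¹ y`
  -- is the transport of the vertex `i`.
  ⟨c, BorelConstruction.mk (Realization.mk (chaoticSimplex fun i =>
    (morRep c (σ.spoke i) ((congrArg objClass (σ.dom_spoke i)).trans e))⁻¹) t,
    objRep c (σ.vert 0) e)⟩

theorem continuous_borelPoint {n : ℕ} (σ : Nerve (twistGroupoid p h G X) n)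
    (c : Quotient (conjSetoid p h G)) (e : objClass (σ.vert 0) = c) :
    Continuous fun t => borelPoint σ t c e :=
  (continuous_sigmaMk (σ := fun c : Quotient (conjSetoid p h G) =>
    BorelConstruction (TwistHom c.out c.out) (FixedSpace c.out X)) (i := c)).comp
    (BorelConstruction.continuous_mk.comp
      ((Realization.continuous_mk_right _).prodMk (continuous_const (y := objRep c _ e))))

/-- The class `c` is kept as a variable so that simplices whose classes are only propositionally
equal can be compared in one summand. -/
theorem borelPoint_class {n : ℕ} (σ : Nerve (twistGroupoid p h G X) n)
    (t : stdSimplex ℝ (Fin (n + 1))) (c : Quotient (conjSetoid p h G))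
    (e : objClass (σ.vert 0) = c) : borelPoint σ t _ rfl = borelPoint σ t c e := by
  subst e; rfl

/-- Passing from the initial vertex `0` to `θ 0` multiplies all coordinates on the left by the
transport of `σ.spoke (θ 0)`, and the Borel construction identifies the two points. -/
theorem borelPoint_pull {m n : ℕ} (θ : Fin (m + 1) →o Fin (n + 1))
    (σ : Nerve (twistGroupoid p h G X) n) (t : stdSimplex ℝ (Fin (m + 1))) :
    borelPoint (σ.pull θ) t _ rfl = borelPoint σ (stdSimplex.map θ t) _ rfl := by
  rw [borelPoint_class (σ.pull θ) t _ (objClass_vert σ (θ 0))]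
  refine congrArg (Sigma.mk _) (Eq.symm (Quot.sound
    ⟨morRep _ (σ.spoke (θ 0)) (congrArg objClass (σ.dom_spoke _)), Prod.ext ?_ ?_⟩))
  · rw [← Realization.mk_pull]
    refine congrArg (fun σ => Realization.mk σ t) ?_
    refine (chaoticSimplex_vert _).symm.trans ((congrArg chaoticSimplex (funext fun i => ?_)).trans
      (chaoticSimplex_vert _))
    change (morRep _ ((σ.pull θ).spoke i) _)⁻¹ =
      morRep _ (σ.spoke (θ 0)) _ * (morRep _ (σ.spoke (θ i)) _)⁻¹
    have key := morRep_comp (objClass (σ.vert 0)) ((σ.pull θ).spoke i) (σ.spoke (θ 0))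
      (((σ.pull θ).dom_spoke i).trans (σ.cod_spoke (θ 0)).symm)
      ((congrArg objClass ((σ.pull θ).dom_spoke i)).trans (objClass_vert σ (θ 0)))
      (congrArg objClass (σ.dom_spoke (θ 0)))
    have h2 : ∀ (k : TwistMor p h G X) (e : k = σ.spoke (θ i)) e1,
        morRep (objClass (σ.vert 0)) (σ.spoke (θ i)) (congrArg objClass (σ.dom_spoke (θ i))) =
          morRep _ k e1 := by
      rintro k rfl _; rfl
    rw [h2 _ (σ.spoke_eq_comp θ i).symm (congrArg objClass (σ.dom_spoke (θ 0)))]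
    erw [key]
    rw [mul_inv_rev, mul_inv_cancel_left]
  · exact (morRep_smul _ _ (σ.dom_spoke _) (σ.cod_spoke _) _ _ _).symm

/-- The morphisms from the objects to their transports. -/
def repMorSelf (x : (twistGroupoid p h G X).Obj) : (twistGroupoid p h G X).Mor :=
  repMor (objClass x) x rfl

theorem dom_repMorSelf (x : (twistGroupoid p h G X).Obj) :
    (twistGroupoid p h G X).dom (repMorSelf x) = x := rfl

theorem repMorSelf_eq (c : Quotient (conjSetoid p h G)) (x : (twistGroupoid p h G X).Obj)
    (e : objClass x = c) : repMorSelf x = repMor c x e := by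
  subst e; rfl

variable [DiscreteTopology X]

instance : DiscreteTopology (twistGroupoid p h G X).Obj :=
  inferInstanceAs (DiscreteTopology (TwistObj p h G X))

instance : DiscreteTopology (twistGroupoid p h G X).Mor :=
  inferInstanceAs (DiscreteTopology (TwistMor p h G X))

/-- The map `ET(α) ×_{T(α)} X ^ (im α) → Twist^gpd(X)` given by
`[(t_0, …, t_n), y] ↦ (t_0⁻¹ y, …, t_n⁻¹ y)`. -/
def borelToGpd (α : ZpPow p h →ₜ* G) :
    C(BorelConstruction (TwistHom α α) (FixedSpace α X), TwistGpd p h G X) where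
  toFun := Quot.lift (fun w : UniversalSpace (TwistHom α α) × FixedSpace α X =>
      (orbitHom α w.2).realize w.1) (by
    rintro ⟨w, y⟩ _ ⟨a, rfl⟩
    change (orbitHom α y).realize w =
      ((orbitHom α (a • y)).realize.comp (chaoticTranslate a).realize) w
    rw [← Hom.realize_comp, orbitHom_smul])
  continuous_toFun := continuous_quot_lift _ <|
    show Continuous fun w : UniversalSpace (TwistHom α α) × FixedSpace α X =>
      (orbitHom α w.2).realize w.1 from
    -- `FixedSpace α X` is discrete, so one `y` at a time suffices.
    continuous_prod_of_discrete_right.2 fun y => (orbitHom α y).realize.continuous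

variable (p h G X) in
/-- The map `Twist(X) → Twist^gpd(X)` assembled from the maps `borelToGpd`. -/
def twistToGpd : C(Twist p h G X, TwistGpd p h G X) where
  toFun z := borelToGpd z.1.out z.2
  continuous_toFun := continuous_sigma fun c => (borelToGpd c.out).continuous

variable (p h G X) in
/-- The map `Twist^gpd(X) → Twist(X)` that transports simplices to the chosen representatives. -/
def gpdToTwist : C(TwistGpd p h G X, Twist p h G X) where
  toFun := Quot.lift (fun z => borelPoint z.2.1 z.2.2 _ rfl) (by
    rintro _ _ ⟨θ, σ, t⟩
    exact borelPoint_pull θ σ t)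
  continuous_toFun := continuous_quot_lift _ (continuous_sigma fun n =>
    continuous_prod_of_discrete_left.2 fun σ => continuous_borelPoint σ _ rfl)

/-! ## The two maps are mutually inverse up to homotopy -/

/-- The spokes of the image simplex are `v_i⁻¹ v_0`, so the round trip gives the coordinates `v_0⁻¹
v_i` over `v_0⁻¹ y`: the original point translated by `v_0⁻¹`. -/
theorem gpdToTwist_comp_twistToGpd :
    (gpdToTwist p h G X).comp (twistToGpd p h G X) = ContinuousMap.id _ := by
  refine ContinuousMap.ext ?_
  rintro ⟨c, ⟨⟨n, σ, t⟩, y⟩⟩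
  change borelPoint (Nerve.push (orbitHom c.out y) σ) t _ rfl =
    ⟨c, BorelConstruction.mk (Realization.mk σ t, y)⟩
  refine (borelPoint_class (Nerve.push (orbitHom c.out y) σ) t c c.out_eq).trans ?_
  let v : Fin (n + 1) → TwistHom c.out c.out := σ.vert
  have hσ : chaoticSimplex v = σ := chaoticSimplex_vert σ
  clear_value v
  subst hσ
  refine congrArg (Sigma.mk c) (Eq.symm (Quot.sound ⟨(v 0)⁻¹, Prod.ext ?_ ?_⟩))
  · refine congrArg (fun σ => Realization.mk σ t) ?_
    refine congrArg chaoticSimplex (funext fun i => ?_)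
    change (TwistHom.comp (toRep c c.out _) (TwistHom.comp ((v i)⁻¹ * v 0)
      (TwistHom.inv (toRep c c.out _))))⁻¹ = (v 0)⁻¹ * v i
    rw [toRep_out]
    change (1 * (((v i)⁻¹ * v 0) * 1⁻¹))⁻¹ = (v 0)⁻¹ * v i
    group
  · change (toRep c c.out _).act _ = _
    rw [toRep_out]
    exact one_smul (TwistHom c.out c.out) ((v 0)⁻¹ • y)

theorem conj_repMorSelf_obj (c : Quotient (conjSetoid p h G))
    (x : (twistGroupoid p h G X).Obj) (e : objClass x = c) :
    (conj repMorSelf dom_repMorSelf).obj x = (⟨c.out, objRep c x e⟩ : TwistObj p h G X) :=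
  congrArg TwistMor.cod (repMorSelf_eq c x e)

theorem conj_repMorSelf_mor (c : Quotient (conjSetoid p h G))
    (m : TwistMor p h G X) (e : objClass m.dom = c) :
    (conj repMorSelf dom_repMorSelf).mor m =
      (⟨(c.out, c.out), (morRep c m e, objRep c m.dom e)⟩ : TwistMor p h G X) := by
  refine (eq_div (𝒢 := twistGroupoid p h G X)
    (a := TwistMor.comp (repMorSelf m.cod) m rfl) (b := repMorSelf m.dom)
    (x := (⟨(c.out, c.out), (morRep c m e, objRep c m.dom e)⟩ : TwistMor p h G X)) rfl
    (congrArg TwistMor.cod (repMorSelf_eq c m.dom e)).symm ?_).symm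
  refine (comp_congr rfl (repMorSelf_eq c m.dom e) _ rfl).trans ?_
  refine (comp_repMor c m e rfl).trans ?_
  exact comp_congr (𝒢 := twistGroupoid p h G X)
    (repMorSelf_eq c m.cod ((objClass_cod m).trans e)).symm rfl rfl (dom_repMorSelf _)

/-- The round trip on a simplex is exactly conjugation by `repMorSelf`. On vertices this is
`morRep_smul` for the spokes; on edges, `morRep` is multiplicative and an edge is a quotient of two
spokes. -/
theorem push_orbitHom_chaoticSimplex {n : ℕ} (σ : Nerve (twistGroupoid p h G X) n)
    (c : Quotient (conjSetoid p h G)) (e : objClass (σ.vert 0) = c) :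
    Nerve.push (orbitHom c.out (objRep c (σ.vert 0) e)) (chaoticSimplex fun i =>
      (morRep c (σ.spoke i) ((congrArg objClass (σ.dom_spoke i)).trans e))⁻¹) =
      Nerve.push (conj repMorSelf dom_repMorSelf) σ := by
  have hv : ∀ i, (morRep c (σ.spoke i) ((congrArg objClass (σ.dom_spoke i)).trans e))⁻¹⁻¹ •
      objRep c (σ.vert 0) e = objRep c (σ.vert i) ((objClass_vert σ i).trans e) := fun i => by
    rw [inv_inv]
    exact morRep_smul c _ (σ.dom_spoke i) (σ.cod_spoke i) _ _ _
  refine Nerve.ext (funext fun i => ?_) (funext ?_)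
  · refine Eq.trans ?_ (conj_repMorSelf_obj c _ ((objClass_vert σ i).trans e)).symm
    exact congrArg (Sigma.mk c.out) (hv i)
  · rintro ⟨⟨i, j⟩, hij⟩
    have hd : (σ.edge ⟨(i, j), hij⟩ : TwistMor p h G X).dom = σ.vert i := σ.dom_edge _
    have he : objClass (σ.edge ⟨(i, j), hij⟩ : TwistMor p h G X).dom = c :=
      (congrArg objClass hd).trans ((objClass_vert σ i).trans e)
    refine Eq.trans ?_ (conj_repMorSelf_mor c _ he).symm
    refine congrArg (Sigma.mk (c.out, c.out)) (Prod.ext ?_ ?_)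
    · change (morRep c (σ.spoke j) _)⁻¹⁻¹ * (morRep c (σ.spoke i) _)⁻¹ = morRep c _ he
      rw [inv_inv, mul_inv_eq_iff_eq_mul]
      have key := morRep_comp c (σ.edge ⟨(i, j), hij⟩) (σ.spoke i)
        (hd.trans (σ.cod_spoke i).symm) he ((congrArg objClass (σ.dom_spoke i)).trans e)
      refine Eq.trans ?_ key
      congr 1
      exact σ.edge_trans 0 i j (Fin.zero_le i) hij
    · refine (hv i).trans ?_
      congr 1
      exact hd.symm

theorem twistToGpd_comp_gpdToTwist :
    (twistToGpd p h G X).comp (gpdToTwist p h G X) =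
      (conj repMorSelf dom_repMorSelf).realize := by
  refine ContinuousMap.ext ?_
  rintro ⟨n, σ, t⟩
  exact congrArg (fun σ => Realization.mk σ t) (push_orbitHom_chaoticSimplex σ _ rfl)

variable (p h G X) in
/-- For discrete `X`, the two forms of the construction `Twist` are homotopy equivalent. -/
def twistHomotopyEquivGpd : Twist p h G X ≃ₕ TwistGpd p h G X where
  toFun := twistToGpd p h G X
  invFun := gpdToTwist p h G X
  left_inv := by
    rw [gpdToTwist_comp_twistToGpd]
  right_inv := by
    rw [twistToGpd_comp_gpdToTwist]
    exact conj_homotopic_id _ _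

end TwistComparison

/-! ## The comparison map for a subgroup is an equivalence -/

section Subgroup

theorem smul_mk_one_eq_iff {G : Type u} [Group G] (H : Subgroup G) (g k : G) :
    g • ((1 : G) : G ⧸ H) = (k : G ⧸ H) ↔ g⁻¹ * k ∈ H := by
  rw [MulAction.Quotient.smul_coe, QuotientGroup.eq, smul_eq_mul, mul_one]

variable {p : ℕ} [Fact p.Prime] {h : ℕ}
variable {G : Type u} [Group G] [TopologicalSpace G] (H : Subgroup G)

/-- An element `j` relating two pairs over `G` already relates them over `H`. -/
theorem TwistHom.incl_injective (α β : ZpPow p h →ₜ* H) :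
    Function.Injective fun τ : TwistHom α β => τ.incl H := by
  intro τ τ' e
  induction τ using TwistHom.ind
  induction τ' using TwistHom.ind
  obtain ⟨j, h1, h2⟩ := Quotient.exact e
  exact Quotient.sound ⟨j, Subtype.ext h1, h2⟩

/-- The stabilizer of `eH` is `H`, so `g` lies in `H` and the conjugation identity restricts to `H`.
-/
theorem TwistHom.exists_incl_eq {α β : ZpPow p h →ₜ* H}
    (τ : TwistHom (inclHom H α) (inclHom H β)) (e : τ.act (baseCoset H α) = baseCoset H β) :
    ∃ τ' : TwistHom α β, τ'.incl H = τ := by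
  induction τ using TwistHom.ind with
  | H g hg t =>
    have hgH : g ∈ H := by
      have := (smul_mk_one_eq_iff H g 1).1 (congrArg Subtype.val e)
      rwa [mul_one, inv_mem_iff] at this
    exact ⟨TwistHom.mk ⟨g, hgH⟩ (fun j => Subtype.ext (hg j)) t, rfl⟩

variable [DiscreteTopology G]

instance : DiscreteTopology (G ⧸ H) :=
  discreteTopology_iff_forall_isOpen.2 fun _ => isOpen_coinduced.2 (isOpen_discrete _)

theorem twistIncl_fullyFaithful : (twistIncl p h H).FullyFaithful := by
  -- Between discrete spaces only bijectivity is left to prove.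
  refine ⟨continuous_of_discreteTopology, fun _ _ => isOpen_discrete _, ?_, ?_⟩
  · rintro ⟨⟨α, β⟩, τ, x⟩ ⟨⟨α', β'⟩, τ', x'⟩ e
    have e' := congrArg Subtype.val e
    obtain rfl : α = α' := congrArg (fun q => Sigma.fst q.2.1) e'
    obtain rfl : β = β' := congrArg (fun q => Sigma.fst q.2.2) e'
    have h1 := eq_of_heq (Sigma.mk.inj (congrArg Prod.fst e')).2
    obtain rfl : τ = τ' := TwistHom.incl_injective H α β (congrArg Prod.fst h1)
    obtain rfl : x = x' := Subsingleton.elim (α := FixedSpace α PUnit) x x'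
    rfl
  · rintro ⟨⟨⟨⟨α', β'⟩, τ, z⟩, ⟨α, x⟩, ⟨β, y⟩⟩, e⟩
    have hd : (⟨α', z⟩ : TwistObj p h G (G ⧸ H)) = ⟨inclHom H α, baseCoset H α⟩ :=
      congrArg Prod.fst e
    have hc : (⟨β', τ.act z⟩ : TwistObj p h G (G ⧸ H)) = ⟨inclHom H β, baseCoset H β⟩ :=
      congrArg Prod.snd e
    obtain ⟨rfl, hz⟩ := Sigma.mk.inj hd
    obtain rfl := eq_of_heq hz
    obtain ⟨rfl, hy⟩ := Sigma.mk.inj hc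
    obtain ⟨τ', rfl⟩ := TwistHom.exists_incl_eq H τ (eq_of_heq hy)
    exact ⟨⟨(α, β), (τ', x)⟩, Subtype.ext (Prod.ext rfl (Prod.ext rfl
      (congrArg (Sigma.mk β) (Subsingleton.elim (α := FixedSpace β PUnit) _ _))))⟩

theorem exists_conjugate_into_subgroup {α : ZpPow p h →ₜ* G} {g : G}
    (hg : ∀ j, g⁻¹ * α j * g ∈ H) :
    ∃ β : ZpPow p h →ₜ* H, g ∈ Conjugators (inclHom H β) α := by
  refine ⟨⟨⟨⟨fun j => ⟨g⁻¹ * α j * g, hg j⟩, ?_⟩, ?_⟩, ?_⟩, fun j => ?_⟩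
  · exact Subtype.ext (by simp)
  · intro j k
    refine Subtype.ext ?_
    change g⁻¹ * α (j * k) * g = (g⁻¹ * α j * g) * (g⁻¹ * α k * g)
    rw [map_mul]
    group
  · exact ((continuous_of_discreteTopology (f := fun a : G => g⁻¹ * a * g)).comp
      (map_continuous α)).subtype_mk _
  · change g * (g⁻¹ * α j * g) * g⁻¹ = α j
    group

theorem twistIncl_essSurjective : (twistIncl p h H).EssSurjective := by
  rintro ⟨α, z, hz⟩
  obtain ⟨g, rfl⟩ := QuotientGroup.mk_surjective z
  obtain ⟨β, hβ⟩ := exists_conjugate_into_subgroup H (α := α) (g := g) fun j => by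
    have := FixedSpace.smul_eq (α := α) ⟨(g : G ⧸ H), hz⟩ j
    rw [MulAction.Quotient.smul_coe] at this
    have := QuotientGroup.eq.1 this.symm
    rwa [smul_eq_mul, ← mul_assoc] at this
  -- Points are open, so a section over the single point `gH` suffices: the morphism `[g, 0]` from
  -- `eH`.
  refine ⟨{⟨α, (g : G ⧸ H), hz⟩}, isOpen_discrete _, rfl, fun _ =>
    ⟨(⟨(inclHom H β, α), (TwistHom.mk g hβ 0, baseCoset H β)⟩,
      ⟨β, PUnit.unit, fun _ => rfl⟩), rfl⟩, continuous_const, ?_⟩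
  rintro ⟨_, rfl⟩
  refine congrArg (Sigma.mk α) (Subtype.ext ?_)
  exact (smul_mk_one_eq_iff H g g).2 (by simp)

theorem twistIncl_isEquivalence : (twistIncl p h H).IsEquivalence :=
  ⟨twistIncl_fullyFaithful H, twistIncl_essSurjective H⟩

end Subgroup

end

theorem mainTheorem7 {p : ℕ} [Fact p.Prime] (h : ℕ) {G : Type u} [Group G] [Finite G]
    [TopologicalSpace G] [DiscreteTopology G] (H : Subgroup G)
    (hH : ∀ a ∈ H, ∀ b ∈ H, a * b = b * a) :
    (twistIncl p h H).IsEquivalence ∧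
    (∃ e : TwistGpd p h H PUnit.{u + 1} ≃ₕ TwistGpd p h G (G ⧸ H),
      e.toFun = (twistIncl p h H).realize) ∧
    Nonempty (Twist p h G (G ⧸ H) ≃ₕ Twist p h H PUnit.{u + 1}) := by
  have hF := twistIncl_isEquivalence (p := p) (h := h) H
  obtain ⟨e, he⟩ := hF.exists_homotopyEquiv
  exact ⟨hF, ⟨e, he⟩, ⟨((twistHomotopyEquivGpd p h G (G ⧸ H)).trans e.symm).trans
    (twistHomotopyEquivGpd p h H PUnit.{u + 1}).symm⟩⟩
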